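/- **Setting.** For $n\in\mathbb N$, $\beta,K>0$ the mean-field Blume–Capel model is the probability measure $P_{n,\beta,K}$ on $\{-1,0,1\}^n$ giving $\omega$ the mass $3^{-n}e^{-\beta H_{n,K}(\omega)}/Z_n(\beta,K)$, where $H_{n,K}(\omega)=\sum_j\omega_j^2-\frac Kn S_n(\omega)^2$, $S_n(\omega)=\sum_{j=1}^n\omega_j$, and $Z_n(\beta,K)$ is the normalization. Let $$G_{\beta,K}(x)=\beta Kx^2-c_\beta(2\beta Kx),\qquad c_\beta(t)=\log\frac{1+e^{-\beta}(e^t+e^{-t})}{1+2e^{-\beta}},$$ and let $\mathcal M_{\beta,K}\subset[-1,1]$ be the set of global minimum points of $G_{\beta,K}$. The phase-coexistence region is the set of $(\beta,K)$, $\beta,K>0$, for which $\mathcal M_{\beta,K}$ has more than one element; there $m(\beta,K)>0$ denotes the positive (largest) element of $\mathcal M_{\beta,K}$. Put $\beta_c=\log 4$ and $K(\beta)=(e^\beta+2)/(4\beta)$ for $\beta>0$. **Hypotheses.** Let $0<\beta\le\beta_c$, $\alpha_0>0$, $\theta>0$, and for each $\alpha\in(0,\alpha_0)$ let $(\beta_n,K_n)=(\beta_n^{(\alpha)},K_n^{(\alpha)})$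 be a sequence converging to $(\beta,K(\beta))$. Assume that there are an even polynomial $g$ of degree $4$ or $6$ with $g(x)\to\infty$ as $|x|\to\infty$, a number $\bar x>0$, and a polynomial $H$ with $H(x)\to\infty$ as $|x|\to\infty$, none of them depending on $\alpha$, such that the set of global minimum points of $g$ is $\{\pm\bar x\}$ and, for every $\alpha\in(0,\alpha_0)$: (i) $(\beta_n,K_n)$ lies in the phase-coexistence region (in particular $\beta_n,K_n>0$) for all sufficiently large $n$; (ii) the limits $b=\lim_n n^\alpha(\beta_n-\beta)$ and $k=\lim_n n^\alpha(K_n-K(\beta))$ exist, are not both $0$, and $b\in\{1,-1\}$ if $b\ne0$; (iii) $n^{\alpha/\alpha_0}G_{\beta_n,K_n}(x/n^{\theta\alpha})\to g(x)$ uniformly for $x$ in compact subsets of $\mathbb R$; (iv) there is $R>0$ such that for all sufficiently large $n$ and all $x$ with $|x/n^{\theta\alpha}|<R$, $n^{\alpha/\alpha_0}G_{\beta_n,K_n}(x/n^{\theta\alpha})\ge H(x)$; (iii$'$) $\theta\alpha_0\in[1/4,1/2)$ if $\deg g=4$, $\theta\alpha_0\in[1/6,1/2)$ if $\deg g=6$,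 and for every integer $2\le j\le\deg g$ $$\lim_{n\to\infty}n^{\alpha/\alpha_0-j\theta\alpha}\,G^{(j)}_{\beta_n,K_n}(m(\beta_n,K_n))=g^{(j)}(\bar x)>0 .$$ **Theorem.** (a) Under these hypotheses, for every $0<\alpha<\alpha_0$, $S_n/n^{1-\theta\alpha}$ satisfies the moderate deviation principle with respect to $P_{n,\beta_n,K_n}$ with speed $n^{1-\alpha/\alpha_0}$ and rate function $\Gamma(x)=g(x)-\inf_{y\in\mathbb R}g(y)$. That is, $\Gamma$ is nonnegative and continuous, $\Gamma(x)\to\infty$ as $|x|\to\infty$, and for every closed $F\subset\mathbb R$ and every open $U\subset\mathbb R$ $$\limsup_{n\to\infty}\frac1{n^{1-\alpha/\alpha_0}}\log P_{n,\beta_n,K_n}\{S_n/n^{1-\theta\alpha}\in F\}\le-\inf_{x\in F}\Gamma(x),$$ $$\liminf_{n\to\infty}\frac1{n^{1-\alpha/\alpha_0}}\log P_{n,\beta_n,K_n}\{S_n/n^{1-\theta\alpha}\in U\}\ge-\inf_{x\in U}\Gamma(x),$$ where $\log 0=-\infty$ and $\inf\emptyset=+\infty$. (b) The hypotheses are satisfied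 (for suitable $g$, $\bar x$, $H$) by each of the following sequences with the indicated $\alpha_0,\theta$. - 1a ($\alpha_0=\theta=\frac12$): $0<\beta<\beta_c$, $b\in\{1,0,-1\}$, $k\ne0$, $K'(\beta)b-k<0$; $\beta_n=\beta+b/n^\alpha$, $K_n=K(\beta)+k/n^\alpha$. - 2a ($\alpha_0=\frac1{2p}$, $\theta=\frac p2$): $0<\beta<\beta_c$, $b\in\{1,-1\}$, $p\ge2$ an integer, $\ell\in\mathbb R$, $(K^{(p)}(\beta)-\ell)b^p<0$; $\beta_n=\beta+b/n^\alpha$, $K_n=K(\beta)+\sum_{j=1}^{p-1}K^{(j)}(\beta)b^j/(j!\,n^{j\alpha})+\ell b^p/(p!\,n^{p\alpha})$. - 3a ($\alpha_0=\frac23$, $\theta=\frac14$): $b\in\{1,0,-1\}$, $k\ne0$, $K'(\beta_c)b-k<0$; $\beta_n=\beta_c+b/n^\alpha$, $K_n=K(\beta_c)+k/n^\alpha$. - 4a ($\alpha_0=\frac13$, $\theta=\frac12$): $\ell,\tilde\ell\in\mathbb R$, $\ell>\ell_c:=K''(\beta_c)-\frac5{4\beta_c}$; $\beta_n=\beta_c+1/n^\alpha$,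 $K_n=K(\beta_c)+K'(\beta_c)/n^\alpha+\ell/(2n^{2\alpha})+\tilde\ell/(6n^{3\alpha})$. - 5a ($\alpha_0=\frac13$, $\theta=\frac12$): $\ell>K''(\beta_c)$; $\beta_n=\beta_c-1/n^\alpha$, $K_n=K(\beta_c)-K'(\beta_c)/n^\alpha+\ell/(2n^{2\alpha})$. -/

import Mathlib

open Filter Topology MeasureTheory

noncomputable section

namespace BlumeCapel

/-! ## The mean-field Blume–Capel model -/

/-- The spin values `Λ = {-1, 0, 1}`. -/
abbrev Spin : Type := ({-1, 0, 1} : Finset ℤ)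

/-- The configuration space `Λ ^ n`. -/
abbrev Config (n : ℕ) : Type := Fin n → Spin

/-- The total spin `S_n(ω) = ∑_j ω_j`. -/
def totalSpin (n : ℕ) (ω : Config n) : ℝ := ∑ j, ((ω j : ℤ) : ℝ)

/-- The Hamiltonian `H_{n,K}(ω) = ∑_j ω_j ^ 2 - (K / n) (∑_j ω_j) ^ 2`. -/
def hamiltonian (n : ℕ) (K : ℝ) (ω : Config n) : ℝ :=
  ∑ j, ((ω j : ℤ) : ℝ) ^ 2 - K / n * (totalSpin n ω) ^ 2

/-- The weight `exp (-β H_{n,K}(ω)) · 3 ^ {-n}`. -/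
def weight (n : ℕ) (β K : ℝ) (ω : Config n) : ℝ :=
  Real.exp (-β * hamiltonian n K ω) * (3 ^ n)⁻¹

/-- The partition function `Z_n(β, K)`. -/
def partitionFn (n : ℕ) (β K : ℝ) : ℝ := ∑ ω : Config n, weight n β K ω

/-- The canonical ensemble `P_{n,β,K}`, the measure on `Λ ^ n` that gives each configuration `ω` the
mass `exp (-β H_{n,K}(ω)) · 3 ^ {-n} / Z_n(β, K)`. -/
def gibbs (n : ℕ) (β K : ℝ) : Measure (Config n) :=
  ∑ ω : Config n, ENNReal.ofReal (weight n β K ω / partitionFn n β K) • Measure.dirac ω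

/-! ## Free energy and phase structure -/

/-- The cumulant generating function
`c_β(t) = log ((1 + e^{-β} (e^t + e^{-t})) / (1 + 2 e^{-β}))`. -/
def cumulant (β t : ℝ) : ℝ :=
  Real.log ((1 + Real.exp (-β) * (Real.exp t + Real.exp (-t))) / (1 + 2 * Real.exp (-β)))

/-- The free-energy function `G_{β,K}(x) = β K x ^ 2 - c_β(2 β K x)`. -/
def freeEnergy (β K x : ℝ) : ℝ := β * K * x ^ 2 - cumulant β (2 * β * K * x)

/-- The set `M_{β,K}` of equilibrium macrostates: the points of `[-1, 1]` that are global minimum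
points of `G_{β,K}`. -/
def macrostates (β K : ℝ) : Set ℝ :=
  {x | x ∈ Set.Icc (-1 : ℝ) 1 ∧ ∀ y : ℝ, freeEnergy β K x ≤ freeEnergy β K y}

/-- The phase-coexistence region: the points of the open positive quadrant for which `M_{β,K}` has
more than one element. -/
def phaseCoexistence : Set (ℝ × ℝ) :=
  {p | 0 < p.1 ∧ 0 < p.2 ∧ (macrostates p.1 p.2).Nontrivial}

/-- The thermodynamic magnetization `m(β, K)`. In the phase-coexistence region `M_{β,K}` equals
`{±m}` or `{0, ±m}` with `m > 0`, so that `m` is its largest element. -/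
def magnetization (β K : ℝ) : ℝ := sSup (macrostates β K)

/-- The critical inverse temperature `β_c = log 4`. -/
def betaC : ℝ := Real.log 4

/-- The function `K(β) = (e ^ β + 2) / (4 β)`, whose graph over `0 < β < β_c` is the second-order
curve and whose point over `β_c` is the tricritical point. -/
def Kcurve (β : ℝ) : ℝ := (Real.exp β + 2) / (4 * β)

/-! ## Hypotheses on the parameter sequences -/

/-- The hypotheses on a sequence `(β_n, K_n)` that is parametrized by `α`: `βs α n` and `Ks α n` are
`β_n` and `K_n` for the parameter `α`. The sequence converges to `(β, K(β))`; `g` is the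
Ginzburg–Landau polynomial, `± xbar` are its global minimum points, and `α₀`, `θ` are the scaling
exponents. -/
structure Hypotheses (β : ℝ) (βs Ks : ℝ → ℕ → ℝ) (g : Polynomial ℝ) (α₀ θ xbar : ℝ) : Prop where
  /-- The limit is a second-order point or the tricritical point. -/
  beta_pos : 0 < β
  beta_le : β ≤ betaC
  alpha₀_pos : 0 < α₀
  theta_pos : 0 < θ
  tendsto_beta : ∀ α, 0 < α → α < α₀ → Tendsto (βs α) atTop (𝓝 β)
  tendsto_K : ∀ α, 0 < α → α < α₀ → Tendsto (Ks α) atTop (𝓝 (Kcurve β))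
  /-- For large `n` the point `(β_n, K_n)` lies in the phase-coexistence region. -/
  coexistence : ∀ α, 0 < α → α < α₀ → ∀ᶠ n in atTop, (βs α n, Ks α n) ∈ phaseCoexistence
  /-- The parameter `α` regulates the speed of approach. -/
  speed : ∀ α, 0 < α → α < α₀ → ∃ b k : ℝ,
    Tendsto (fun n : ℕ => (n : ℝ) ^ α * (βs α n - β)) atTop (𝓝 b) ∧
    Tendsto (fun n : ℕ => (n : ℝ) ^ α * (Ks α n - Kcurve β)) atTop (𝓝 k) ∧
    ¬(b = 0 ∧ k = 0) ∧ (b ≠ 0 → b = 1 ∨ b = -1)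
  /-- `g` is an even polynomial of degree `4` or `6` that tends to `∞` as `|x| → ∞`. -/
  g_even : ∀ x : ℝ, g.eval (-x) = g.eval x
  g_degree : g.natDegree = 4 ∨ g.natDegree = 6
  g_coercive : Tendsto (fun x : ℝ => g.eval x) (cocompact ℝ) atTop
  /-- `n ^ (α/α₀) G_{β_n,K_n}(x / n ^ (θα)) → g(x)`, uniformly for `x` in compact sets. -/
  tendsto_g : ∀ α, 0 < α → α < α₀ → ∀ C : Set ℝ, IsCompact C →
    TendstoUniformlyOn
      (fun (n : ℕ) (x : ℝ) =>
        (n : ℝ) ^ (α / α₀) * freeEnergy (βs α n) (Ks α n) (x / (n : ℝ) ^ (θ * α)))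
      (fun x => g.eval x) atTop C
  /-- The set of global minimum points of `g` equals `{± xbar}`. -/
  xbar_pos : 0 < xbar
  g_minimizers : {x : ℝ | ∀ y : ℝ, g.eval x ≤ g.eval y} = {xbar, -xbar}
  /-- A polynomial lower bound for the rescaled free energy. -/
  lower_bound : ∃ H : Polynomial ℝ, Tendsto (fun x : ℝ => H.eval x) (cocompact ℝ) atTop ∧
    ∀ α, 0 < α → α < α₀ → ∃ R : ℝ, 0 < R ∧ ∀ᶠ n : ℕ in atTop, ∀ x : ℝ,
      |x / (n : ℝ) ^ (θ * α)| < R →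
        H.eval x ≤ (n : ℝ) ^ (α / α₀) * freeEnergy (βs α n) (Ks α n) (x / (n : ℝ) ^ (θ * α))
  /-- The admissible range of `θ α₀`, depending on the degree of `g`. -/
  range_four : g.natDegree = 4 → θ * α₀ ∈ Set.Ico (1 / 4 : ℝ) (1 / 2)
  range_six : g.natDegree = 6 → θ * α₀ ∈ Set.Ico (1 / 6 : ℝ) (1 / 2)
  /-- Asymptotics of the derivatives of orders `2, …, deg g` at the magnetization. -/
  deriv_pos : ∀ j ∈ Finset.Icc 2 g.natDegree, 0 < (Polynomial.derivative^[j] g).eval xbar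
  tendsto_deriv : ∀ α, 0 < α → α < α₀ → ∀ j ∈ Finset.Icc 2 g.natDegree,
    Tendsto
      (fun n : ℕ => (n : ℝ) ^ (α / α₀ - j * (θ * α)) *
        iteratedDeriv j (freeEnergy (βs α n) (Ks α n)) (magnetization (βs α n) (Ks α n)))
      atTop (𝓝 ((Polynomial.derivative^[j] g).eval xbar))

/-! ## Moderate deviation principles -/

/-- The random variables `X n` on `(Ω n, P n)` satisfy the moderate deviation principle with speed
`a n` and rate function `Γ`: `Γ` is nonnegative and continuous with `Γ(x) → ∞` as `|x| → ∞`, and the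
upper bound for closed sets and the lower bound for open sets hold. Logarithms and infima are
extended-real valued, so that `log 0 = -∞` and the infimum over the empty set is `+∞`. -/
structure SatisfiesMDP {Ω : ℕ → Type} [∀ n, MeasurableSpace (Ω n)] (P : ∀ n, Measure (Ω n))
    (X : ∀ n, Ω n → ℝ) (a : ℕ → ℝ) (Γ : ℝ → ℝ) : Prop where
  rate_nonneg : ∀ x, 0 ≤ Γ x
  rate_continuous : Continuous Γ
  rate_coercive : Tendsto Γ (cocompact ℝ) atTop
  upper : ∀ F : Set ℝ, IsClosed F →
    limsup (fun n => ((1 / a n : ℝ) : EReal) * ENNReal.log (P n {ω | X n ω ∈ F})) atTop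
      ≤ -(⨅ x ∈ F, (Γ x : EReal))
  lower : ∀ G : Set ℝ, IsOpen G →
    -(⨅ x ∈ G, (Γ x : EReal))
      ≤ liminf (fun n => ((1 / a n : ℝ) : EReal) * ENNReal.log (P n {ω | X n ω ∈ G})) atTop

/-! ## The five parameter sequences -/

/-- `β_n = β + b / n ^ α`. -/
def betaRay (β b α : ℝ) (n : ℕ) : ℝ := β + b / (n : ℝ) ^ α

/-- `K_n = K(β) + k / n ^ α`. -/
def KRay (β k α : ℝ) (n : ℕ) : ℝ := Kcurve β + k / (n : ℝ) ^ α

/-- `K_n = K(β) + ∑_{j=1}^{p-1} K^{(j)}(β) b^j / (j! n^{jα}) + ℓ b^p / (p! n^{pα})`. -/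
def KTaylor (β b : ℝ) (p : ℕ) (l α : ℝ) (n : ℕ) : ℝ :=
  Kcurve β
    + ∑ j ∈ Finset.Ico 1 p,
        iteratedDeriv j Kcurve β * b ^ j / ((j.factorial : ℝ) * (n : ℝ) ^ ((j : ℝ) * α))
    + l * b ^ p / ((p.factorial : ℝ) * (n : ℝ) ^ ((p : ℝ) * α))

/-- `K_n = K(β_c) + K'(β_c) / n^α + ℓ / (2 n^{2α}) + ℓ' / (6 n^{3α})`. -/
def KRight (l l' α : ℝ) (n : ℕ) : ℝ :=
  Kcurve betaC + deriv Kcurve betaC / (n : ℝ) ^ α + l / (2 * (n : ℝ) ^ (2 * α))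
    + l' / (6 * (n : ℝ) ^ (3 * α))

/-- `K_n = K(β_c) - K'(β_c) / n^α + ℓ / (2 n^{2α})`. -/
def KLeft (l α : ℝ) (n : ℕ) : ℝ :=
  Kcurve betaC - deriv Kcurve betaC / (n : ℝ) ^ α + l / (2 * (n : ℝ) ^ (2 * α))

end BlumeCapel

end

open BlumeCapel

namespace BlumeCapel

/-! ### The finite-volume identities behind the moderate deviation bounds -/

lemma one_add_two_exp_pos (β : ℝ) : 0 < 1 + 2 * Real.exp (-β) := by positivity

lemma exp_cumulant (β t : ℝ) : Real.exp (cumulant β t) =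
    (1 + Real.exp (-β) * (Real.exp t + Real.exp (-t))) / (1 + 2 * Real.exp (-β)) :=
  Real.exp_log (by positivity)

/-- The normalization `((1 + 2 e^{-β}) / 3) ^ n` of the single-site measures. -/
noncomputable def siteNorm (n : ℕ) (β : ℝ) : ℝ := ((1 + 2 * Real.exp (-β)) / 3) ^ n

lemma siteNorm_pos (n : ℕ) (β : ℝ) : 0 < siteNorm n β := by
  unfold siteNorm; positivity

lemma weight_pos (n : ℕ) (β K : ℝ) (ω : Config n) : 0 < weight n β K ω := by
  unfold weight; positivity

lemma sum_spin_exp (β t : ℝ) :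
    ∑ a : Spin, Real.exp (-β * ((a : ℤ) : ℝ) ^ 2 + t * ((a : ℤ) : ℝ)) =
      1 + Real.exp (-β) * (Real.exp t + Real.exp (-t)) := by
  rw [Finset.sum_coe_sort ({-1, 0, 1} : Finset ℤ)
    (fun a : ℤ => Real.exp (-β * (a : ℝ) ^ 2 + t * (a : ℝ)))]
  rw [Finset.sum_insert (by decide), Finset.sum_insert (by decide), Finset.sum_singleton]
  simp only [Int.cast_neg, Int.cast_one, Int.cast_zero]
  have h1 : Real.exp (-β * (-1) ^ 2 + t * -1) = Real.exp (-β) * Real.exp (-t) := by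
    rw [← Real.exp_add]; congr 1; ring
  have h2 : Real.exp (-β * 1 ^ 2 + t * 1) = Real.exp (-β) * Real.exp t := by
    rw [← Real.exp_add]; congr 1; ring
  have h3 : Real.exp (-β * 0 ^ 2 + t * 0) = 1 := by norm_num
  rw [h1, h2, h3]; ring

/-- The pointwise form of the Hubbard–Stratonovich transformation. -/
lemma sum_weight_mul_exp {n : ℕ} (hn : n ≠ 0) (β K z : ℝ) :
    ∑ ω : Config n, weight n β K ω * Real.exp (-(n * (β * K) * (z - totalSpin n ω / n) ^ 2)) =
      siteNorm n β * Real.exp (-(n * freeEnergy β K z)) := by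
  have hn' : (n : ℝ) ≠ 0 := Nat.cast_ne_zero.mpr hn
  have hω (ω : Config n) :
      weight n β K ω * Real.exp (-(n * (β * K) * (z - totalSpin n ω / n) ^ 2)) =
        (3 ^ n)⁻¹ * Real.exp (-(n * (β * K) * z ^ 2)) *
          ∏ j, Real.exp (-β * ((ω j : ℤ) : ℝ) ^ 2 + 2 * β * K * z * ((ω j : ℤ) : ℝ)) := by
    rw [← Real.exp_sum, Finset.sum_add_distrib, ← Finset.mul_sum, ← Finset.mul_sum]
    change weight n β K ω * _ = _ * Real.exp (_ + _ * totalSpin n ω)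
    unfold weight hamiltonian
    rw [mul_right_comm, ← Real.exp_add, mul_comm, mul_assoc ((3 ^ n)⁻¹ : ℝ), ← Real.exp_add]
    congr 2
    field_simp
    ring
  rw [Finset.sum_congr rfl fun ω _ => hω ω, ← Finset.mul_sum, ← Fintype.sum_pow
    (fun a : Spin => Real.exp (-β * ((a : ℤ) : ℝ) ^ 2 + 2 * β * K * z * ((a : ℤ) : ℝ))),
    sum_spin_exp]
  have : Real.exp (-(n * freeEnergy β K z)) = Real.exp (-(n * (β * K) * z ^ 2)) *
      Real.exp (cumulant β (2 * β * K * z)) ^ n := by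
    rw [← Real.exp_nat_mul, ← Real.exp_add]
    unfold freeEnergy
    congr 1; ring
  rw [this, exp_cumulant, siteNorm, div_pow, div_pow]
  field_simp [(one_add_two_exp_pos β).ne']

lemma abs_totalSpin_le (n : ℕ) (ω : Config n) : |totalSpin n ω| ≤ n := by
  unfold totalSpin
  refine (Finset.abs_sum_le_sum_abs _ _).trans ?_
  calc ∑ j, |((ω j : ℤ) : ℝ)| ≤ ∑ _j : Fin n, (1 : ℝ) := by
        refine Finset.sum_le_sum fun j _ => ?_
        have h := (ω j).2
        simp only [Finset.mem_insert, Finset.mem_singleton] at h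
        rcases h with h | h | h <;> simp [h]
    _ = n := by simp

/-- The unnormalized mass of a set of configurations. -/
noncomputable def mass (n : ℕ) (β K : ℝ) (A : Set (Config n)) : ℝ :=
  ∑ ω, A.indicator (weight n β K) ω

lemma mass_univ (n : ℕ) (β K : ℝ) : mass n β K Set.univ = partitionFn n β K := by
  simp [mass, partitionFn]

lemma partitionFn_pos (n : ℕ) (β K : ℝ) : 0 < partitionFn n β K :=
  Finset.sum_pos (fun ω _ => weight_pos n β K ω)
    ⟨fun _ => ⟨0, by decide⟩, Finset.mem_univ _⟩

lemma gibbs_apply (n : ℕ) (β K : ℝ) (A : Set (Config n)) :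
    gibbs n β K A = ENNReal.ofReal (mass n β K A / partitionFn n β K) := by
  have hA : MeasurableSet A := A.toFinite.measurableSet
  unfold gibbs mass
  rw [Measure.finsetSum_apply, Finset.sum_div, ENNReal.ofReal_sum_of_nonneg]
  · refine Finset.sum_congr rfl fun ω _ => ?_
    by_cases h : ω ∈ A <;> simp [h]
  · intro ω _
    exact div_nonneg (Set.indicator_nonneg (fun ω _ => (weight_pos n β K ω).le) ω)
      (partitionFn_pos n β K).le

/-- Upper bound for the mass of a set, in terms of the free energy on its image. -/
lemma mass_le {n : ℕ} (hn : n ≠ 0) {β K L : ℝ} {A : Set (Config n)}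
    (h : ∀ ω ∈ A, L ≤ n * freeEnergy β K (totalSpin n ω / n)) :
    mass n β K A ≤ (2 * n + 1) * (siteNorm n β * Real.exp (-L)) := by
  classical
  let T : Config n → ℤ := fun ω => ∑ j, (ω j : ℤ)
  have hT (ω : Config n) : (T ω : ℝ) = totalSpin n ω := by simp [T, totalSpin]
  have hmem (ω : Config n) : T ω ∈ Finset.Icc (-(n : ℤ)) n := by
    have := abs_le.mp (abs_totalSpin_le n ω)
    rw [← hT] at this
    rw [Finset.mem_Icc]
    exact ⟨by exact_mod_cast this.1, by exact_mod_cast this.2⟩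
  unfold mass
  rw [← Finset.sum_fiberwise_of_maps_to (fun ω _ => hmem ω)]
  have hfib : ∀ s ∈ Finset.Icc (-(n : ℤ)) n,
      ∑ ω with T ω = s, A.indicator (weight n β K) ω ≤ siteNorm n β * Real.exp (-L) := by
    intro s _
    by_cases hs : ∃ ω ∈ A, T ω = s
    · obtain ⟨ω₀, hω₀, rfl⟩ := hs
      calc ∑ ω with T ω = T ω₀, A.indicator (weight n β K) ω
          ≤ ∑ ω with T ω = T ω₀, weight n β K ω *
              Real.exp (-(n * (β * K) * (totalSpin n ω₀ / n - totalSpin n ω / n) ^ 2)) := by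
            refine Finset.sum_le_sum fun ω hω => ?_
            have hω' : totalSpin n ω = totalSpin n ω₀ := by
              rw [← hT, ← hT, (Finset.mem_filter.mp hω).2]
            rw [hω']
            simpa using Set.indicator_le_self' (fun ω _ => (weight_pos n β K ω).le) ω
        _ ≤ ∑ ω, weight n β K ω *
              Real.exp (-(n * (β * K) * (totalSpin n ω₀ / n - totalSpin n ω / n) ^ 2)) :=
            Finset.sum_le_sum_of_subset_of_nonneg (Finset.filter_subset _ _)
              fun ω _ _ => mul_nonneg (weight_pos n β K ω).le (Real.exp_pos _).le
        _ = siteNorm n β * Real.exp (-(n * freeEnergy β K (totalSpin n ω₀ / n))) :=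
            sum_weight_mul_exp hn β K _
        _ ≤ siteNorm n β * Real.exp (-L) :=
            mul_le_mul_of_nonneg_left (Real.exp_le_exp.mpr (neg_le_neg (h ω₀ hω₀)))
              (siteNorm_pos n β).le
    · push Not at hs
      rw [Finset.sum_eq_zero]
      · exact mul_nonneg (siteNorm_pos n β).le (Real.exp_pos _).le
      · intro ω hω
        exact Set.indicator_of_notMem (fun h' => hs ω h' (Finset.mem_filter.mp hω).2) _
  refine (Finset.sum_le_card_nsmul _ _ _ hfib).trans_eq ?_
  rw [nsmul_eq_mul, Int.card_Icc]
  congr 1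
  have : ((n : ℤ) + 1 - -(n : ℤ)).toNat = 2 * n + 1 := by omega
  rw [this]; push_cast; ring

/-- Lower bound for the mass of a neighbourhood. -/
lemma le_mass {n : ℕ} (hn : n ≠ 0) {β K z ε : ℝ} (hβK : 0 ≤ β * K) (hε : 0 ≤ ε)
    {A : Set (Config n)} (hA : ∀ ω, |totalSpin n ω / n - z| < ε → ω ∈ A) :
    siteNorm n β * Real.exp (-(n * freeEnergy β K z)) -
      partitionFn n β K * Real.exp (-(n * (β * K) * ε ^ 2)) ≤ mass n β K A := by
  rw [← sum_weight_mul_exp hn, sub_le_iff_le_add]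
  unfold mass partitionFn
  rw [Finset.sum_mul, ← Finset.sum_add_distrib]
  refine Finset.sum_le_sum fun ω _ => ?_
  have hw := weight_pos n β K ω
  have hnβ : 0 ≤ n * (β * K) := by positivity
  by_cases h : ω ∈ A
  · rw [Set.indicator_of_mem h]
    have h1 : Real.exp (-(n * (β * K) * (z - totalSpin n ω / n) ^ 2)) ≤ 1 :=
      Real.exp_le_one_iff.mpr (neg_nonpos.mpr (by positivity))
    have h2 := mul_le_mul_of_nonneg_left h1 hw.le
    have h3 := mul_pos hw (Real.exp_pos (-(n * (β * K) * ε ^ 2)))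
    linarith
  · rw [Set.indicator_of_notMem h, zero_add]
    refine mul_le_mul_of_nonneg_left (Real.exp_le_exp.mpr (neg_le_neg ?_)) hw.le
    refine mul_le_mul_of_nonneg_left ?_ hnβ
    have h1 : ε ≤ |totalSpin n ω / n - z| := not_lt.mp fun h' => h (hA ω h')
    rw [← abs_of_nonneg hε] at h1
    have := sq_le_sq.mpr h1
    linarith [this, sub_sq_comm z (totalSpin n ω / n)]

/-! ### The free energy -/

lemma cumulant_neg (β t : ℝ) : cumulant β (-t) = cumulant β t := by
  unfold cumulant; rw [neg_neg, add_comm (Real.exp (-t))]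

lemma freeEnergy_neg (β K x : ℝ) : freeEnergy β K (-x) = freeEnergy β K x := by
  unfold freeEnergy; rw [mul_neg, cumulant_neg, neg_sq]

@[simp] lemma freeEnergy_zero (β K : ℝ) : freeEnergy β K 0 = 0 := by
  have : 1 + Real.exp (-β) * (1 + 1) = 1 + 2 * Real.exp (-β) := by ring
  simp [freeEnergy, cumulant, this, (one_add_two_exp_pos β).ne']

lemma contDiff_freeEnergy :
    ContDiff ℝ ⊤ (fun p : (ℝ × ℝ) × ℝ => freeEnergy p.1.1 p.1.2 p.2) := by
  unfold freeEnergy cumulant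
  refine ContDiff.sub (by fun_prop) (ContDiff.log (ContDiff.div (by fun_prop) (by fun_prop) ?_) ?_)
  · intro p; positivity
  · intro p; positivity

lemma three_mul_sinh_lt {t : ℝ} (ht : 0 < t) :
    3 * Real.sinh t < 2 * t + t * Real.cosh t := by
  have key : ∀ (f f' : ℝ → ℝ), (∀ x, HasDerivAt f (f' x) x) → f 0 = 0 →
      (∀ x, 0 < x → 0 < f' x) → ∀ x, 0 < x → 0 < f x := by
    intro f f' hd h0 hpos x hx
    have hmono : StrictMonoOn f (Set.Ici 0) := by
      refine strictMonoOn_of_deriv_pos (convex_Ici 0)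
        (fun y _ => (hd y).continuousAt.continuousWithinAt) fun y hy => ?_
      rw [interior_Ici] at hy
      rw [(hd y).deriv]; exact hpos y hy
    have := hmono Set.self_mem_Ici hx.le hx
    rwa [h0] at this
  have h2 : ∀ x : ℝ, 0 < x → 0 < x * Real.cosh x - Real.sinh x :=
    key _ (fun x => x * Real.sinh x)
      (fun x => by
        have := ((hasDerivAt_id x).mul (Real.hasDerivAt_cosh x)).sub (Real.hasDerivAt_sinh x)
        refine this.congr_deriv ?_; simp only [id]; ring)
      (by simp) (fun x hx => mul_pos hx (Real.sinh_pos_iff.mpr hx))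
  have h1 : ∀ x : ℝ, 0 < x → 0 < 2 - 2 * Real.cosh x + x * Real.sinh x :=
    key _ (fun x => x * Real.cosh x - Real.sinh x)
      (fun x => by
        have := (((Real.hasDerivAt_cosh x).const_mul 2).const_sub 2).add
          ((hasDerivAt_id x).mul (Real.hasDerivAt_sinh x))
        refine this.congr_deriv ?_; simp only [id]; ring)
      (by simp) h2
  have h0 : ∀ x : ℝ, 0 < x → 0 < 2 * x - 3 * Real.sinh x + x * Real.cosh x :=
    key _ (fun x => 2 - 2 * Real.cosh x + x * Real.sinh x)
      (fun x => by
        have := (((hasDerivAt_id x).const_mul 2).sub ((Real.hasDerivAt_sinh x).const_mul 3)).add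
          ((hasDerivAt_id x).mul (Real.hasDerivAt_cosh x))
        refine this.congr_deriv ?_; simp only [id]; ring)
      (by simp) h1
  linarith [h0 t ht]

lemma cumulant_eq (β t : ℝ) : cumulant β t =
    Real.log (Real.exp β + 2 * Real.cosh t) - Real.log (Real.exp β + 2) := by
  have hc := Real.cosh_pos t
  unfold cumulant
  rw [← Real.log_div (by positivity) (by positivity), Real.exp_neg, Real.cosh_eq]
  congr 1
  field_simp

lemma hasDerivAt_cumulant (β t : ℝ) :
    HasDerivAt (cumulant β) (2 * Real.sinh t / (Real.exp β + 2 * Real.cosh t)) t := by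
  have hc := Real.cosh_pos t
  have : HasDerivAt (fun t => Real.log (Real.exp β + 2 * Real.cosh t) - Real.log (Real.exp β + 2))
      (2 * Real.sinh t / (Real.exp β + 2 * Real.cosh t)) t :=
    ((((Real.hasDerivAt_cosh t).const_mul 2).const_add _).log (by positivity)).sub_const _
  exact this.congr_of_eventuallyEq (Eventually.of_forall fun t => cumulant_eq β t)

lemma hasDerivAt_freeEnergy (β K x : ℝ) :
    HasDerivAt (freeEnergy β K) (2 * β * K * (x - 2 * Real.sinh (2 * β * K * x) /
      (Real.exp β + 2 * Real.cosh (2 * β * K * x)))) x := by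
  have h1 := (hasDerivAt_id x).const_mul (2 * β * K)
  have h2 := (((hasDerivAt_id x).pow 2).const_mul (β * K)).sub
    ((hasDerivAt_cumulant β (2 * β * K * x)).comp x h1)
  have h3 : HasDerivAt (freeEnergy β K) _ x := h2
  convert h3 using 1
  simp
  ring

lemma exp_le_four {β : ℝ} (hβ : β ≤ betaC) : Real.exp β ≤ 4 := by
  rw [← Real.exp_log (show (0 : ℝ) < 4 by norm_num)]
  exact Real.exp_le_exp.mpr hβ

lemma Kcurve_pos {β : ℝ} (hβ : 0 < β) : 0 < Kcurve β := by
  unfold Kcurve; positivity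

/-- On the second-order curve and at the tricritical point, `0` is the only global minimum point of
the free energy. -/
lemma freeEnergy_Kcurve_pos {β x : ℝ} (hβ : 0 < β) (hβc : β ≤ betaC) (hx : x ≠ 0) :
    0 < freeEnergy β (Kcurve β) x := by
  wlog hpos : 0 < x generalizing x
  · rw [← freeEnergy_neg]
    exact this (neg_ne_zero.mpr hx) (by linarith [lt_of_le_of_ne (not_lt.mp hpos) hx])
  have hmono : StrictMonoOn (freeEnergy β (Kcurve β)) (Set.Ici 0) := by
    refine strictMonoOn_of_deriv_pos (convex_Ici 0)
      (fun y _ => (hasDerivAt_freeEnergy β _ y).continuousAt.continuousWithinAt) fun y hy => ?_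
    rw [interior_Ici] at hy
    rw [(hasDerivAt_freeEnergy β _ y).deriv]
    have hK := Kcurve_pos hβ
    have hy' : (0 : ℝ) < y := hy
    have ht : 0 < 2 * β * Kcurve β * y := by positivity
    have hty : 2 * β * Kcurve β = (Real.exp β + 2) / 2 := by
      unfold Kcurve; field_simp; ring
    refine mul_pos (by positivity) ?_
    set t := 2 * β * Kcurve β * y with ht_def
    have hc := Real.cosh_pos t
    have hA := exp_le_four hβc
    have hA0 := Real.exp_pos β
    have hyt : y = 2 * t / (Real.exp β + 2) := by
      rw [ht_def, hty]; field_simp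
    rw [hyt, sub_pos, div_lt_div_iff₀ (by positivity) (by positivity)]
    have h1 := three_mul_sinh_lt ht
    have h2 : t < Real.sinh t := Real.self_lt_sinh_iff.mpr ht
    nlinarith [mul_nonneg (sub_nonneg.mpr hA) (sub_nonneg.mpr h2.le)]
  have := hmono Set.self_mem_Ici hpos.le hpos
  rwa [freeEnergy_zero] at this

/-- Near a point of the second-order curve or the tricritical point, the free energy is bounded away
from zero on compact sets that do not contain `0`. -/
lemma exists_freeEnergy_gt {β : ℝ} (hβ : 0 < β) (hβc : β ≤ betaC) {S : Set ℝ} (hS : IsCompact S)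
    (h0 : (0 : ℝ) ∉ S) :
    ∃ c : ℝ, 0 < c ∧ ∀ᶠ p : ℝ × ℝ in 𝓝 (β, Kcurve β), ∀ x ∈ S, c < freeEnergy p.1 p.2 x := by
  obtain ⟨c, hc, hcS⟩ : ∃ c : ℝ, 0 < c ∧ ∀ x ∈ S, c < freeEnergy β (Kcurve β) x := by
    rcases S.eq_empty_or_nonempty with rfl | hne
    · exact ⟨1, one_pos, by simp⟩
    obtain ⟨x₀, hx₀, hmin⟩ := hS.exists_isMinOn hne
      (f := freeEnergy β (Kcurve β))
      fun y _ => (hasDerivAt_freeEnergy β _ y).continuousAt.continuousWithinAt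
    have hp : 0 < freeEnergy β (Kcurve β) x₀ :=
      freeEnergy_Kcurve_pos hβ hβc fun h => h0 (h ▸ hx₀)
    exact ⟨freeEnergy β (Kcurve β) x₀ / 2, by linarith, fun x hx => by
      have : freeEnergy β (Kcurve β) x₀ ≤ freeEnergy β (Kcurve β) x := hmin hx
      linarith⟩
  refine ⟨c, hc, hS.eventually_forall_of_forall_eventually fun x hx => ?_⟩
  exact contDiff_freeEnergy.continuous.continuousAt.eventually
    (lt_mem_nhds (hcS x hx))

/-! ### The moderate deviation principle -/

lemma inv_mul_log_le {a z : ℝ} (ha : 0 < a) {p : ENNReal}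
    (h : p ≤ ENNReal.ofReal (Real.exp (a * z))) :
    ((1 / a : ℝ) : EReal) * ENNReal.log p ≤ (z : EReal) := by
  have h1 : ENNReal.log p ≤ ((a * z : ℝ) : EReal) := by
    have := ENNReal.log_le_log h
    rwa [ENNReal.log_ofReal_of_pos (Real.exp_pos _), Real.log_exp] at this
  calc ((1 / a : ℝ) : EReal) * ENNReal.log p ≤ ((1 / a : ℝ) : EReal) * ((a * z : ℝ) : EReal) :=
        mul_le_mul_of_nonneg_left h1 (by exact_mod_cast (by positivity : (0 : ℝ) ≤ 1 / a))
    _ = (z : EReal) := by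
        rw [← EReal.coe_mul]; congr 1; field_simp

lemma le_inv_mul_log {a z : ℝ} (ha : 0 < a) {p : ENNReal}
    (h : ENNReal.ofReal (Real.exp (a * z)) ≤ p) :
    (z : EReal) ≤ ((1 / a : ℝ) : EReal) * ENNReal.log p := by
  have h1 : ((a * z : ℝ) : EReal) ≤ ENNReal.log p := by
    have := ENNReal.log_le_log h
    rwa [ENNReal.log_ofReal_of_pos (Real.exp_pos _), Real.log_exp] at this
  calc (z : EReal) = ((1 / a : ℝ) : EReal) * ((a * z : ℝ) : EReal) := by
        rw [← EReal.coe_mul]; congr 1; field_simp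
    _ ≤ ((1 / a : ℝ) : EReal) * ENNReal.log p :=
        mul_le_mul_of_nonneg_left h1 (by exact_mod_cast (by positivity : (0 : ℝ) ≤ 1 / a))

lemma tendsto_natCast_rpow_atTop {r : ℝ} (hr : 0 < r) :
    Tendsto (fun n : ℕ => (n : ℝ) ^ r) atTop atTop :=
  (tendsto_rpow_atTop hr).comp tendsto_natCast_atTop_atTop

lemma eventually_two_mul_add_one_le_exp {r η : ℝ} (hr : 0 < r) (hη : 0 < η) :
    ∀ᶠ n : ℕ in atTop, 2 * (n : ℝ) + 1 ≤ Real.exp ((n : ℝ) ^ r * η) := by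
  have h1 := ((isLittleO_log_rpow_atTop hr).comp_tendsto
    tendsto_natCast_atTop_atTop).bound (half_pos hη)
  have h2 := (tendsto_natCast_rpow_atTop hr).eventually_ge_atTop (Real.log 3 / (η / 2))
  filter_upwards [h1, h2, eventually_ge_atTop 1] with n h1 h2 hn
  have hn' : (1 : ℝ) ≤ n := by exact_mod_cast hn
  simp only [Function.comp_apply, Real.norm_eq_abs] at h1
  rw [abs_of_nonneg (Real.log_nonneg hn'), abs_of_nonneg (by positivity)] at h1
  rw [div_le_iff₀ (by positivity)] at h2
  calc 2 * (n : ℝ) + 1 ≤ 3 * n := by linarith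
    _ = Real.exp (Real.log 3 + Real.log n) := by
        rw [Real.exp_add, Real.exp_log (by norm_num), Real.exp_log (by linarith)]
    _ ≤ _ := Real.exp_le_exp.mpr (by linarith)

section MDP

variable {β : ℝ} {βs Ks : ℝ → ℕ → ℝ} {g : Polynomial ℝ} {α₀ θ xbar α : ℝ}

lemma Hypotheses.two_mul_theta_lt (h : Hypotheses β βs Ks g α₀ θ xbar) (hα : 0 < α) :
    2 * (θ * α) < α / α₀ := by
  have h1 : θ * α₀ < 1 / 2 := by
    rcases h.g_degree with hd | hd
    · exact (h.range_four hd).2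
    · exact (h.range_six hd).2
  rw [lt_div_iff₀ h.alpha₀_pos]
  nlinarith

lemma Hypotheses.speed_pos (h : Hypotheses β βs Ks g α₀ θ xbar) (hα' : α < α₀) :
    0 < 1 - α / α₀ := by
  rw [sub_pos, div_lt_one h.alpha₀_pos]; exact hα'

lemma Hypotheses.g_le (h : Hypotheses β βs Ks g α₀ θ xbar) (y : ℝ) :
    g.eval xbar ≤ g.eval y := by
  have : xbar ∈ {x : ℝ | ∀ y : ℝ, g.eval x ≤ g.eval y} := by simp [h.g_minimizers]
  exact this y

lemma Hypotheses.iInf_eq (h : Hypotheses β βs Ks g α₀ θ xbar) :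
    ⨅ y : ℝ, g.eval y = g.eval xbar :=
  le_antisymm (ciInf_le ⟨g.eval xbar, by rintro _ ⟨y, rfl⟩; exact h.g_le y⟩ xbar)
    (le_ciInf h.g_le)

lemma Hypotheses.eventually_le_freeEnergy (h : Hypotheses β βs Ks g α₀ θ xbar) (hα : 0 < α)
    (hα' : α < α₀) {F : Set ℝ} {M M' : ℝ} (hM : M < M') (hF : ∀ x ∈ F, M' ≤ g.eval x) :
    ∀ᶠ n : ℕ in atTop, ∀ u ∈ F, |u / (n : ℝ) ^ (θ * α)| ≤ 1 →
      M ≤ (n : ℝ) ^ (α / α₀) * freeEnergy (βs α n) (Ks α n) (u / (n : ℝ) ^ (θ * α)) := by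
  obtain ⟨H, hH, hlow⟩ := h.lower_bound
  obtain ⟨R, hR, hlow⟩ := hlow α hα hα'
  obtain ⟨C, hC, hCM⟩ := (hasBasis_cocompact.eventually_iff).mp (hH.eventually_ge_atTop M)
  have hunif := Metric.tendstoUniformlyOn_iff.mp (h.tendsto_g α hα hα' C hC) (M' - M)
    (sub_pos.mpr hM)
  have hS : IsCompact (Set.Icc (-1 : ℝ) 1 ∩ {x | R ≤ |x|}) :=
    isCompact_Icc.inter_right (isClosed_le continuous_const continuous_abs)
  obtain ⟨c, hc, hev⟩ := exists_freeEnergy_gt h.beta_pos h.beta_le hS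
    (fun h0 => by have := h0.2; simp at this; linarith)
  have hev := ((h.tendsto_beta α hα hα').prodMk_nhds (h.tendsto_K α hα hα')).eventually hev
  have hinf := ((tendsto_natCast_rpow_atTop (div_pos hα h.alpha₀_pos)).atTop_mul_const
    hc).eventually_ge_atTop M
  filter_upwards [hlow, hunif, hev, hinf] with n hlow hunif hev hinf u hu hu1
  by_cases huC : u ∈ C
  · have := hunif u huC
    rw [Real.dist_eq] at this
    linarith [(abs_lt.mp this).2, hF u hu]
  · by_cases huR : |u / (n : ℝ) ^ (θ * α)| < R
    · exact (hCM huC).trans (hlow u huR)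
    · exact hinf.trans (mul_le_mul_of_nonneg_left
        (hev _ ⟨abs_le.mp hu1, not_lt.mp huR⟩).le (by positivity))

lemma rpow_one_sub_mul {n : ℕ} (hn : n ≠ 0) (r : ℝ) :
    (n : ℝ) ^ (1 - r) * (n : ℝ) ^ r = n := by
  rw [← Real.rpow_add (by positivity), sub_add_cancel, Real.rpow_one]

lemma Hypotheses.eventually_mass_le (h : Hypotheses β βs Ks g α₀ θ xbar) (hα : 0 < α)
    (hα' : α < α₀) {F : Set ℝ} {M M' : ℝ} (hM : M < M') (hF : ∀ x ∈ F, M' ≤ g.eval x) :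
    ∀ᶠ n : ℕ in atTop,
      mass n (βs α n) (Ks α n) {ω | totalSpin n ω / (n : ℝ) ^ (1 - θ * α) ∈ F} ≤
        siteNorm n (βs α n) * Real.exp (-((n : ℝ) ^ (1 - α / α₀) * M)) := by
  obtain ⟨M₁, hM₁, hM₁'⟩ := exists_between hM
  filter_upwards [h.eventually_le_freeEnergy hα hα' hM₁' hF,
    eventually_two_mul_add_one_le_exp (h.speed_pos hα') (sub_pos.mpr hM₁),
    eventually_ne_atTop 0] with n hfe hexp hn
  have key := mass_le hn (β := βs α n) (K := Ks α n) (L := (n : ℝ) ^ (1 - α / α₀) * M₁)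
    (A := {ω | totalSpin n ω / (n : ℝ) ^ (1 - θ * α) ∈ F}) fun ω hω => by
      have hn0 : (0 : ℝ) < n := by positivity
      have hdiv : totalSpin n ω / (n : ℝ) ^ (1 - θ * α) / (n : ℝ) ^ (θ * α) =
          totalSpin n ω / n := by
        rw [div_div, rpow_one_sub_mul hn]
      have := hfe _ hω (by
        rw [hdiv, abs_div, abs_of_pos hn0, div_le_one hn0]
        exact abs_totalSpin_le n ω)
      rw [hdiv] at this
      calc (n : ℝ) ^ (1 - α / α₀) * M₁ ≤ (n : ℝ) ^ (1 - α / α₀) *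
            ((n : ℝ) ^ (α / α₀) * freeEnergy (βs α n) (Ks α n) (totalSpin n ω / n)) :=
            mul_le_mul_of_nonneg_left this (by positivity)
        _ = _ := by rw [← mul_assoc, rpow_one_sub_mul hn]
  refine key.trans ?_
  rw [mul_left_comm]
  refine mul_le_mul_of_nonneg_left ?_ (siteNorm_pos _ _).le
  calc (2 * (n : ℝ) + 1) * Real.exp (-((n : ℝ) ^ (1 - α / α₀) * M₁)) ≤
        Real.exp ((n : ℝ) ^ (1 - α / α₀) * (M₁ - M)) *
          Real.exp (-((n : ℝ) ^ (1 - α / α₀) * M₁)) :=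
        mul_le_mul_of_nonneg_right hexp (Real.exp_pos _).le
    _ = _ := by rw [← Real.exp_add]; congr 1; ring

lemma Hypotheses.eventually_partitionFn_le (h : Hypotheses β βs Ks g α₀ θ xbar) (hα : 0 < α)
    (hα' : α < α₀) {M : ℝ} (hM : M < g.eval xbar) :
    ∀ᶠ n : ℕ in atTop, partitionFn n (βs α n) (Ks α n) ≤
      siteNorm n (βs α n) * Real.exp (-((n : ℝ) ^ (1 - α / α₀) * M)) := by
  filter_upwards [h.eventually_mass_le hα hα' (F := Set.univ) hM fun x _ => h.g_le x] with n hn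
  rw [← mass_univ]
  simpa using hn

lemma Hypotheses.eventually_le_mass (h : Hypotheses β βs Ks g α₀ θ xbar) (hα : 0 < α)
    (hα' : α < α₀) {U : Set ℝ} (hU : IsOpen U) {x : ℝ} (hx : x ∈ U) {M : ℝ}
    (hM : g.eval x < M) :
    ∀ᶠ n : ℕ in atTop, siteNorm n (βs α n) * Real.exp (-((n : ℝ) ^ (1 - α / α₀) * M)) ≤
      mass n (βs α n) (Ks α n) {ω | totalSpin n ω / (n : ℝ) ^ (1 - θ * α) ∈ U} := by
  obtain ⟨ε, hε, hball⟩ := Metric.isOpen_iff.mp hU x hx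
  obtain ⟨M₁, hM₁, hM₁'⟩ := exists_between hM
  set κ := β * Kcurve β / 2 with hκ_def
  have hKβ := mul_pos h.beta_pos (Kcurve_pos h.beta_pos)
  have hκ : 0 < κ := by positivity
  have hβK := ((h.tendsto_beta α hα hα').mul (h.tendsto_K α hα hα')).eventually
    (lt_mem_nhds (show κ < β * Kcurve β by linarith))
  have hpt := Metric.tendstoUniformlyOn_iff.mp
    (h.tendsto_g α hα hα' {x} isCompact_singleton) (M₁ - g.eval x) (sub_pos.mpr hM₁)
  have hr : 0 < α / α₀ - 2 * (θ * α) := sub_pos.mpr (h.two_mul_theta_lt hα)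
  have hinf := ((tendsto_natCast_rpow_atTop hr).atTop_mul_const
    (show 0 < κ * ε ^ 2 by positivity)).eventually_ge_atTop (M - (g.eval xbar - 1))
  have htwo := ((tendsto_natCast_rpow_atTop (h.speed_pos hα')).atTop_mul_const
    (sub_pos.mpr hM₁')).eventually_ge_atTop (Real.log 2)
  filter_upwards [hβK, hpt, hinf, htwo, eventually_ne_atTop 0,
    h.eventually_partitionFn_le hα hα' (sub_one_lt (g.eval xbar))]
    with n hβK hpt hinf htwo hn hZ
  have hn0 : (0 : ℝ) < n := by positivity
  set a := (n : ℝ) ^ (1 - α / α₀) with ha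
  set s := (n : ℝ) ^ (θ * α) with hs
  have ha0 : 0 < a := by positivity
  have hs0 : 0 < s := by positivity
  set r := (n : ℝ) ^ (α / α₀ - 2 * (θ * α)) with hr_def
  have hars : n / s ^ 2 = a * r := by
    rw [ha, hs, hr_def, ← Real.rpow_natCast, ← Real.rpow_mul hn0.le, ← Real.rpow_add hn0]
    nth_rewrite 1 [← Real.rpow_one (n : ℝ)]
    rw [← Real.rpow_sub hn0]
    congr 1; push_cast; ring
  have hlow := le_mass hn (β := βs α n) (K := Ks α n) (z := x / s) (ε := ε / s)
    (hκ.trans hβK).le (by positivity)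
    (A := {ω | totalSpin n ω / (n : ℝ) ^ (1 - θ * α) ∈ U}) fun ω hω => by
      refine hball ?_
      have hdiv : totalSpin n ω / (n : ℝ) ^ (1 - θ * α) / s = totalSpin n ω / n := by
        rw [div_div, rpow_one_sub_mul hn]
      rw [← hdiv, ← sub_div, abs_div, abs_of_pos hs0, div_lt_div_iff_of_pos_right hs0] at hω
      exact hω
  refine le_trans ?_ hlow
  have hfirst : Real.exp (-(a * M₁)) ≤
      Real.exp (-(n * freeEnergy (βs α n) (Ks α n) (x / s))) := by
    refine Real.exp_le_exp.mpr (neg_le_neg ?_)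
    have h1 := hpt x rfl
    rw [Real.dist_eq] at h1
    have h2 := (abs_lt.mp h1).1
    calc n * freeEnergy (βs α n) (Ks α n) (x / s) =
          a * ((n : ℝ) ^ (α / α₀) * freeEnergy (βs α n) (Ks α n) (x / s)) := by
          rw [← mul_assoc, rpow_one_sub_mul hn]
      _ ≤ a * M₁ := mul_le_mul_of_nonneg_left (by linarith) ha0.le
  have hsecond : partitionFn n (βs α n) (Ks α n) *
      Real.exp (-(n * (βs α n * Ks α n) * (ε / s) ^ 2)) ≤
        siteNorm n (βs α n) * Real.exp (-(a * M)) := by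
    refine (mul_le_mul_of_nonneg_right hZ (Real.exp_pos _).le).trans ?_
    rw [mul_assoc, ← Real.exp_add]
    refine mul_le_mul_of_nonneg_left (Real.exp_le_exp.mpr ?_) (siteNorm_pos _ _).le
    have e1 : n * (βs α n * Ks α n) * (ε / s) ^ 2 = a * (r * (βs α n * Ks α n * ε ^ 2)) := by
      rw [← mul_assoc a, ← hars]; field_simp
    have e2 : κ * ε ^ 2 ≤ βs α n * Ks α n * ε ^ 2 :=
      mul_le_mul_of_nonneg_right hβK.le (by positivity)
    have e3 : r * (κ * ε ^ 2) ≤ r * (βs α n * Ks α n * ε ^ 2) :=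
      mul_le_mul_of_nonneg_left e2 (by positivity)
    rw [e1]
    have e4 : a * (M - (g.eval xbar - 1)) ≤ a * (r * (βs α n * Ks α n * ε ^ 2)) :=
      mul_le_mul_of_nonneg_left (hinf.trans e3) ha0.le
    linarith
  have htwo' : 2 * Real.exp (-(a * M)) ≤ Real.exp (-(a * M₁)) := by
    nth_rewrite 1 [← Real.exp_log (show (0 : ℝ) < 2 by norm_num)]
    rw [← Real.exp_add]
    exact Real.exp_le_exp.mpr (by linarith)
  have h3 := mul_le_mul_of_nonneg_left (htwo'.trans hfirst) (siteNorm_pos n (βs α n)).le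
  linarith

lemma Hypotheses.eventually_le_partitionFn (h : Hypotheses β βs Ks g α₀ θ xbar) (hα : 0 < α)
    (hα' : α < α₀) {M : ℝ} (hM : g.eval xbar < M) :
    ∀ᶠ n : ℕ in atTop, siteNorm n (βs α n) * Real.exp (-((n : ℝ) ^ (1 - α / α₀) * M)) ≤
      partitionFn n (βs α n) (Ks α n) := by
  filter_upwards [h.eventually_le_mass hα hα' isOpen_univ (Set.mem_univ xbar) hM] with n hn
  rw [← mass_univ]
  simpa using hn

theorem Hypotheses.satisfiesMDP (h : Hypotheses β βs Ks g α₀ θ xbar) (hα : 0 < α)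
    (hα' : α < α₀) :
    SatisfiesMDP
      (fun n => gibbs n (βs α n) (Ks α n))
      (fun n ω => totalSpin n ω / (n : ℝ) ^ (1 - θ * α))
      (fun n => (n : ℝ) ^ (1 - α / α₀))
      (fun x => g.eval x - ⨅ y : ℝ, g.eval y) where
  rate_nonneg x := by rw [h.iInf_eq]; exact sub_nonneg.mpr (h.g_le x)
  rate_continuous := g.continuous.sub continuous_const
  rate_coercive := tendsto_atTop_add_const_right _ _ h.g_coercive
  upper F _ := by
    rw [h.iInf_eq, ← EReal.le_of_forall_lt_iff_le]
    intro z hz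
    rw [EReal.neg_lt_comm, ← EReal.coe_neg] at hz
    obtain ⟨w, hzw, hw⟩ := EReal.lt_iff_exists_real_btwn.mp hz
    have hzw : -z < w := by exact_mod_cast hzw
    have hF : ∀ x ∈ F, w + g.eval xbar ≤ g.eval x := fun x hx => by
      have : (w : EReal) ≤ ((g.eval x - g.eval xbar : ℝ) : EReal) :=
        hw.le.trans (iInf₂_le x hx)
      linarith [EReal.coe_le_coe_iff.mp this]
    set δ := (w + z) / 3 with hδ
    have hδ0 : 0 < δ := by rw [hδ]; linarith
    refine limsup_le_of_le (by isBoundedDefault) ?_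
    filter_upwards [h.eventually_mass_le hα hα' (sub_lt_self (w + g.eval xbar) hδ0) hF,
      h.eventually_le_partitionFn hα hα' (lt_add_of_pos_right (g.eval xbar) hδ0),
      eventually_ne_atTop 0] with n h1 h2 hn
    have ha : 0 < (n : ℝ) ^ (1 - α / α₀) := by positivity
    refine inv_mul_log_le ha ?_
    rw [gibbs_apply]
    refine ENNReal.ofReal_le_ofReal ?_
    rw [div_le_iff₀ (partitionFn_pos _ _ _)]
    refine h1.trans ((?_ : _ ≤ _).trans (mul_le_mul_of_nonneg_left h2 (Real.exp_pos _).le))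
    rw [mul_left_comm, ← Real.exp_add]
    refine mul_le_mul_of_nonneg_left (Real.exp_le_exp.mpr ?_) (siteNorm_pos _ _).le
    have : (n : ℝ) ^ (1 - α / α₀) * (-z - (w - 2 * δ)) ≤ 0 :=
      mul_nonpos_of_nonneg_of_nonpos ha.le (by rw [hδ]; linarith)
    linarith
  lower U hU := by
    rw [h.iInf_eq, EReal.neg_le]
    refine le_iInf₂ fun x hx => ?_
    rw [EReal.neg_le, ← EReal.coe_neg, ← EReal.ge_of_forall_gt_iff_ge]
    intro z hz
    have hz : z < -(g.eval x - g.eval xbar) := by exact_mod_cast hz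
    set δ := (-z - (g.eval x - g.eval xbar)) / 2 with hδ
    have hδ0 : 0 < δ := by rw [hδ]; linarith
    refine le_liminf_of_le (by isBoundedDefault) ?_
    filter_upwards [h.eventually_le_mass hα hα' hU hx (lt_add_of_pos_right (g.eval x) hδ0),
      h.eventually_partitionFn_le hα hα' (sub_lt_self (g.eval xbar) hδ0),
      eventually_ne_atTop 0] with n h1 h2 hn
    have ha : 0 < (n : ℝ) ^ (1 - α / α₀) := by positivity
    refine le_inv_mul_log ha ?_
    rw [gibbs_apply]
    refine ENNReal.ofReal_le_ofReal ?_
    rw [le_div_iff₀ (partitionFn_pos _ _ _)]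
    refine ((mul_le_mul_of_nonneg_left h2 (Real.exp_pos _).le).trans ?_).trans h1
    rw [mul_left_comm, ← Real.exp_add]
    refine mul_le_mul_of_nonneg_left (Real.exp_le_exp.mpr ?_) (siteNorm_pos _ _).le
    have : (n : ℝ) ^ (1 - α / α₀) * (z - (-(g.eval x - g.eval xbar) - 2 * δ)) = 0 := by
      rw [hδ]; ring
    linarith

end MDP

/-! ### Taylor expansions -/

open scoped ContDiff Nat

lemma iteratedDeriv_comp_add (i j : ℕ) (f : ℝ → ℝ) :
    iteratedDeriv i (iteratedDeriv j f) = iteratedDeriv (i + j) f := by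
  rw [iteratedDeriv_eq_iterate, iteratedDeriv_eq_iterate, iteratedDeriv_eq_iterate,
    Function.iterate_add_apply]

/-- Taylor's formula with a uniform remainder bound on both sides of the centre. -/
lemma abs_sub_taylor_le {a r C : ℝ} (k : ℕ) {f : ℝ → ℝ}
    (hd : ∀ i < k, ∀ x, |x - a| ≤ r → DifferentiableAt ℝ (iteratedDeriv i f) x)
    (hC : ∀ x, |x - a| ≤ r → |iteratedDeriv k f x| ≤ C) :
    ∀ x, |x - a| ≤ r →
      |f x - ∑ i ∈ Finset.range k, iteratedDeriv i f a * (x - a) ^ i / (i ! : ℝ)| ≤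
        C * |x - a| ^ k := by
  induction k generalizing f with
  | zero =>
    intro x hx
    simpa using hC x hx
  | succ k ih =>
    intro x hx
    have ih' := ih (f := deriv f)
      (fun i hi y hy => by
        rw [← iteratedDeriv_succ']; exact hd (i + 1) (by omega) y hy)
      (fun y hy => by rw [← iteratedDeriv_succ']; exact hC y hy)
    set T : ℝ → ℝ := fun y =>
      f y - ∑ i ∈ Finset.range (k + 1), iteratedDeriv i f a * (y - a) ^ i / (i ! : ℝ) with hT
    have hderiv : ∀ y, |y - a| ≤ r → HasDerivAt T (deriv f y -
        ∑ i ∈ Finset.range k, iteratedDeriv i (deriv f) a * (y - a) ^ i / (i ! : ℝ)) y := by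
      intro y hy
      have hfy : HasDerivAt f (deriv f y) y := by
        have := hd 0 (by omega) y hy
        rw [iteratedDeriv_zero] at this
        exact this.hasDerivAt
      refine hfy.sub ?_
      have hterm : ∀ i ∈ Finset.range (k + 1), HasDerivAt
          (fun y => iteratedDeriv i f a * (y - a) ^ i / (i ! : ℝ))
          (iteratedDeriv i f a * (i * (y - a) ^ (i - 1)) / (i ! : ℝ)) y := by
        intro i _
        have := ((((hasDerivAt_id y).sub_const a).pow i).const_mul
          (iteratedDeriv i f a)).div_const (i ! : ℝ)
        refine this.congr_deriv ?_
        simp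
      refine (HasDerivAt.fun_sum hterm).congr_deriv ?_
      rw [Finset.sum_range_succ']
      simp only [Nat.cast_zero, zero_mul, mul_zero, zero_div, add_zero]
      refine Finset.sum_congr rfl fun i _ => ?_
      rw [iteratedDeriv_succ', Nat.factorial_succ, Nat.add_sub_cancel]
      push_cast
      have : (i ! : ℝ) ≠ 0 := by positivity
      field_simp
    have hTa : T a = 0 := by
      simp only [hT, sub_self]
      rw [Finset.sum_range_succ']
      simp
    have hmv := Convex.norm_image_sub_le_of_norm_hasDerivWithin_le (f := T)
      (s := Metric.closedBall a |x - a|) (C := C * |x - a| ^ k) (x := a) (y := x)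
      (fun y hy => (hderiv y ?_).hasDerivWithinAt) (fun y hy => ?_)
      (convex_closedBall _ _) (by simp) (by simp [Real.dist_eq])
    · rw [hTa, sub_zero, Real.norm_eq_abs, Real.norm_eq_abs] at hmv
      calc |T x| ≤ C * |x - a| ^ k * |x - a| := hmv
        _ = _ := by rw [pow_succ]; ring
    · rw [Metric.mem_closedBall, Real.dist_eq] at hy
      exact hy.trans hx
    · rw [Metric.mem_closedBall, Real.dist_eq] at hy
      have hC0 : 0 ≤ C := (abs_nonneg _).trans (hC y (hy.trans hx))
      refine (ih' y (hy.trans hx)).trans ?_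
      gcongr

lemma ContDiffOn.iteratedDeriv_of_isOpen {f : ℝ → ℝ} {s : Set ℝ} (hs : IsOpen s)
    (hf : ContDiffOn ℝ ∞ f s) (k : ℕ) : ContDiffOn ℝ ∞ (iteratedDeriv k f) s := by
  induction k with
  | zero => simpa using hf
  | succ k ih =>
    rw [iteratedDeriv_succ]
    exact ih.deriv_of_isOpen hs (by simp)

lemma contDiff_iteratedDeriv {f : ℝ → ℝ} (hf : ContDiff ℝ ∞ f) (k : ℕ) :
    ContDiff ℝ ∞ (iteratedDeriv k f) :=
  contDiffOn_univ.mp (ContDiffOn.iteratedDeriv_of_isOpen isOpen_univ hf.contDiffOn k)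

/-- Derivatives in one variable of a jointly smooth function are jointly smooth. -/
lemma contDiff_iteratedDeriv_snd {E : Type*} [NormedAddCommGroup E] [NormedSpace ℝ E]
    (j : ℕ) {F : E × ℝ → ℝ} (hF : ContDiff ℝ ∞ F) :
    ContDiff ℝ ∞ (fun p : E × ℝ => iteratedDeriv j (fun x => F (p.1, x)) p.2) := by
  induction j generalizing F with
  | zero => simpa using hF
  | succ j ih =>
    have hF' : ContDiff ℝ ∞ (fun p => fderiv ℝ F p ((0 : E), (1 : ℝ))) :=
      (hF.fderiv_right (by simp)).clm_apply contDiff_const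
    have hd (e : E) : deriv (fun x => F (e, x)) = fun x => fderiv ℝ F (e, x) ((0 : E), (1 : ℝ)) := by
      funext x
      have h1 : HasFDerivAt F (fderiv ℝ F (e, x)) (e, x) :=
        (hF.differentiable (by simp) _).hasFDerivAt
      have h2 : HasDerivAt (fun x : ℝ => (e, x)) ((0 : E), (1 : ℝ)) x :=
        (hasDerivAt_const x e).prodMk (hasDerivAt_id x)
      exact (h1.comp_hasDerivAt x h2).deriv
    simp only [iteratedDeriv_succ', hd]
    exact ih hF'

/-! ### Scaling limits of smooth functions -/

/-- The Taylor expansion of a derivative of `f` after rescaling. -/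
lemma abs_scaled_sub_le {f : ℝ → ℝ} (hf : ContDiff ℝ ∞ f) {N j : ℕ} (hj : j ≤ N) {C s u : ℝ}
    (hC : ∀ x, |x| ≤ 1 → |iteratedDeriv (N + 1) f x| ≤ C) (hs : 0 < s) (hu : |u / s| ≤ 1) :
    |s ^ (N - j) * iteratedDeriv j f (u / s) - ∑ i ∈ Finset.range (N - j + 1),
      s ^ (N - (i + j)) * iteratedDeriv (i + j) f 0 * u ^ i / (i ! : ℝ)| ≤
        C * |u| ^ (N - j + 1) / s := by
  have h := abs_sub_taylor_le (a := 0) (r := 1) (C := C) (N - j + 1) (f := iteratedDeriv j f)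
    (fun i _ x _ => (contDiff_iteratedDeriv (contDiff_iteratedDeriv hf j) i).differentiable
      (by simp) x)
    (fun x hx => by
      rw [iteratedDeriv_comp_add, show N - j + 1 + j = N + 1 by omega]
      exact hC x (by simpa using hx))
    (u / s) (by simpa using hu)
  have h' := mul_le_mul_of_nonneg_left h (pow_pos hs (N - j)).le
  rw [← abs_of_pos (pow_pos hs (N - j)), ← abs_mul, abs_of_pos (pow_pos hs (N - j)), mul_sub,
    Finset.mul_sum] at h'
  have e1 : ∑ i ∈ Finset.range (N - j + 1),
      s ^ (N - (i + j)) * iteratedDeriv (i + j) f 0 * u ^ i / (i ! : ℝ) =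
      ∑ i ∈ Finset.range (N - j + 1),
        s ^ (N - j) * (iteratedDeriv i (iteratedDeriv j f) 0 * (u / s - 0) ^ i / (i ! : ℝ)) := by
    refine Finset.sum_congr rfl fun i hi => ?_
    rw [iteratedDeriv_comp_add, sub_zero, div_pow]
    have hi' : N - j = N - (i + j) + i := by
      have := Finset.mem_range.mp hi; omega
    rw [hi', pow_add]
    field_simp
  rw [e1]
  refine h'.trans_eq ?_
  rw [sub_zero, abs_div, abs_of_pos hs, div_pow, pow_succ s]
  field_simp

lemma eval_iterate_derivative_eq {g : Polynomial ℝ} {N j : ℕ} (hg : g.natDegree ≤ N) (hj : j ≤ N)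
    (u : ℝ) : (Polynomial.derivative^[j] g).eval u = ∑ i ∈ Finset.range (N - j + 1),
      ((i + j)! : ℝ) * g.coeff (i + j) * u ^ i / (i ! : ℝ) := by
  rw [Polynomial.eval_eq_sum_range' (n := N - j + 1)]
  · refine Finset.sum_congr rfl fun i _ => ?_
    rw [Polynomial.coeff_iterate_derivative, nsmul_eq_mul]
    have h1 : (i ! : ℝ) * ((i + j).descFactorial j : ℝ) = ((i + j)! : ℝ) := by
      have := Nat.factorial_mul_descFactorial (show j ≤ i + j by omega)
      rw [Nat.add_sub_cancel] at this
      exact_mod_cast this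
    rw [← h1]
    have : (i ! : ℝ) ≠ 0 := by positivity
    field_simp
  · have := Polynomial.natDegree_iterate_derivative g j
    omega

/-- The total deviation of the rescaled Taylor coefficients of `f` from those of `g`. -/
noncomputable def coeffError (f : ℝ → ℝ) (s : ℝ) (N : ℕ) (g : Polynomial ℝ) : ℝ :=
  ∑ l ∈ Finset.range (N + 1), |s ^ (N - l) * iteratedDeriv l f 0 - (l ! : ℝ) * g.coeff l|

lemma abs_scaled_sub_eval_le {f : ℝ → ℝ} (hf : ContDiff ℝ ∞ f) {N j : ℕ} (hj : j ≤ N)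
    {g : Polynomial ℝ} (hg : g.natDegree ≤ N) {C s u : ℝ}
    (hC : ∀ x, |x| ≤ 1 → |iteratedDeriv (N + 1) f x| ≤ C) (hs : 0 < s) (hu : |u / s| ≤ 1)
    {b : ℝ} (hb : ∀ i ≤ N - j, |u| ^ i ≤ b) :
    |s ^ (N - j) * iteratedDeriv j f (u / s) - (Polynomial.derivative^[j] g).eval u| ≤
      coeffError f s N g * b + C * |u| ^ (N - j + 1) / s := by
  have h1 := abs_scaled_sub_le hf hj hC hs hu
  rw [eval_iterate_derivative_eq hg hj]
  have h2 : |∑ i ∈ Finset.range (N - j + 1),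
        s ^ (N - (i + j)) * iteratedDeriv (i + j) f 0 * u ^ i / (i ! : ℝ) -
      ∑ i ∈ Finset.range (N - j + 1), ((i + j)! : ℝ) * g.coeff (i + j) * u ^ i / (i ! : ℝ)| ≤
      coeffError f s N g * b := by
    rw [← Finset.sum_sub_distrib]
    refine (Finset.abs_sum_le_sum_abs _ _).trans ?_
    calc _ ≤ ∑ i ∈ Finset.range (N - j + 1), |s ^ (N - (i + j)) * iteratedDeriv (i + j) f 0 -
          ((i + j)! : ℝ) * g.coeff (i + j)| * b := by
          refine Finset.sum_le_sum fun i hi => ?_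
          rw [← sub_div, ← sub_mul, abs_div, abs_mul, abs_pow]
          refine (div_le_self (by positivity) ?_).trans ?_
          · rw [Nat.abs_cast]; exact_mod_cast Nat.one_le_iff_ne_zero.mpr (Nat.factorial_ne_zero i)
          · exact mul_le_mul_of_nonneg_left (hb i (by have := Finset.mem_range.mp hi; omega))
              (abs_nonneg _)
      _ = (∑ l ∈ Finset.Ico j (N + 1),
          |s ^ (N - l) * iteratedDeriv l f 0 - (l ! : ℝ) * g.coeff l|) * b := by
          rw [← Finset.sum_mul, Finset.sum_Ico_eq_sum_range, show N + 1 - j = N - j + 1 by omega]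
          congr 1
          refine Finset.sum_congr rfl fun i _ => ?_
          rw [add_comm j i]
      _ ≤ coeffError f s N g * b := by
          refine mul_le_mul_of_nonneg_right ?_ ((pow_nonneg (abs_nonneg u) 0).trans
            (hb 0 (Nat.zero_le _)))
          refine Finset.sum_le_sum_of_subset_of_nonneg (fun l hl => ?_) fun l _ _ => abs_nonneg _
          have := Finset.mem_Ico.mp hl
          exact Finset.mem_range.mpr this.2
  exact (abs_sub_le _ _ _).trans ((add_le_add h1 h2).trans_eq (add_comm _ _))

section Scaling

variable {f : ℕ → ℝ → ℝ} {s : ℕ → ℝ} {N : ℕ} {g : Polynomial ℝ} {C : ℝ}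

lemma tendsto_coeffError
    (hcoef : ∀ l ≤ N, Tendsto (fun n => s n ^ (N - l) * iteratedDeriv l (f n) 0) atTop
      (𝓝 ((l ! : ℝ) * g.coeff l))) :
    Tendsto (fun n => coeffError (f n) (s n) N g) atTop (𝓝 0) := by
  unfold coeffError
  rw [← Finset.sum_const_zero (s := Finset.range (N + 1)) (ι := ℕ)]
  refine tendsto_finsetSum _ fun l hl => ?_
  have := hcoef l (by have := Finset.mem_range.mp hl; omega)
  simpa using (this.sub_const ((l ! : ℝ) * g.coeff l)).abs

theorem tendstoUniformlyOn_scaled (hf : ∀ n, ContDiff ℝ ∞ (f n)) (hs : Tendsto s atTop atTop)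
    (hC : ∀ᶠ n in atTop, ∀ x, |x| ≤ 1 → |iteratedDeriv (N + 1) (f n) x| ≤ C)
    (hg : g.natDegree ≤ N)
    (hcoef : ∀ l ≤ N, Tendsto (fun n => s n ^ (N - l) * iteratedDeriv l (f n) 0) atTop
      (𝓝 ((l ! : ℝ) * g.coeff l)))
    {j : ℕ} (hj : j ≤ N) {S : Set ℝ} (hS : IsCompact S) :
    TendstoUniformlyOn (fun n u => s n ^ (N - j) * iteratedDeriv j (f n) (u / s n))
      (fun u => (Polynomial.derivative^[j] g).eval u) atTop S := by
  obtain ⟨B₀, hB₀⟩ := hS.isBounded.exists_norm_le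
  set B := max B₀ 1 with hB
  have hB1 : 1 ≤ B := le_max_right _ _
  have hlim : Tendsto (fun n => coeffError (f n) (s n) N g * B ^ (N - j) +
      |C| * B ^ (N - j + 1) / s n) atTop (𝓝 0) := by
    have h1 := (tendsto_coeffError hcoef).mul_const (B ^ (N - j))
    have h2 := hs.const_div_atTop (|C| * B ^ (N - j + 1))
    simpa using h1.add h2
  rw [Metric.tendstoUniformlyOn_iff]
  intro ε hε
  filter_upwards [hlim.eventually (gt_mem_nhds hε), hC, hs.eventually_ge_atTop B]
    with n h1 h2 h3 u hu
  have hs0 : 0 < s n := by linarith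
  have huB : |u| ≤ B := (hB₀ u hu).trans (le_max_left _ _)
  rw [dist_comm, Real.dist_eq]
  refine lt_of_le_of_lt (abs_scaled_sub_eval_le (hf n) hj hg h2 hs0 ?_ (b := B ^ (N - j)) ?_)
    (lt_of_le_of_lt ?_ h1)
  · rw [abs_div, abs_of_pos hs0, div_le_one hs0]; linarith
  · intro i hi
    exact (pow_le_pow_left₀ (abs_nonneg u) huB i).trans (pow_le_pow_right₀ hB1 hi)
  · gcongr
    exact le_abs_self C

lemma tendsto_eval_cocompact {p : Polynomial ℝ} (he : ∀ x : ℝ, p.eval (-x) = p.eval x)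
    (hd : 0 < p.degree) (hl : 0 ≤ p.leadingCoeff) :
    Tendsto (fun x : ℝ => p.eval x) (cocompact ℝ) atTop := by
  have htop := p.tendsto_atTop_of_leadingCoeff_nonneg hd hl
  rw [cocompact_eq_atBot_atTop, tendsto_sup]
  refine ⟨?_, htop⟩
  have := htop.comp tendsto_neg_atBot_atTop
  refine this.congr fun x => ?_
  simp [he]

theorem exists_scaled_lower_bound (hN : Even N) (hN0 : 0 < N) (hg : g.natDegree = N)
    (he : ∀ x : ℝ, g.eval (-x) = g.eval x) (hlead : 0 < g.leadingCoeff) :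
    ∃ H : Polynomial ℝ, Tendsto (fun x : ℝ => H.eval x) (cocompact ℝ) atTop ∧
      ∀ (f : ℕ → ℝ → ℝ) (s : ℕ → ℝ) (C : ℝ), (∀ n, ContDiff ℝ ∞ (f n)) → Tendsto s atTop atTop →
      (∀ᶠ n in atTop, ∀ x, |x| ≤ 1 → |iteratedDeriv (N + 1) (f n) x| ≤ C) →
      (∀ l ≤ N, Tendsto (fun n => s n ^ (N - l) * iteratedDeriv l (f n) 0) atTop
        (𝓝 ((l ! : ℝ) * g.coeff l))) →
      ∃ R : ℝ, 0 < R ∧ ∀ᶠ n in atTop, ∀ x : ℝ, |x / s n| < R →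
        H.eval x ≤ s n ^ N * f n (x / s n) := by
  set c := g.leadingCoeff with hc
  set q : Polynomial ℝ := 1 + Polynomial.C (c / 2) * Polynomial.X ^ N with hq
  have hqd : q.natDegree ≤ N := by
    rw [hq]; compute_degree
  have hgN : g.coeff N = c := by rw [hc, Polynomial.leadingCoeff, hg]
  have hqN : q.coeff N = c / 2 := by
    simp [hq, Polynomial.coeff_one, hN0.ne']
  have hHN : (g - q).coeff N = c / 2 := by
    rw [Polynomial.coeff_sub, hgN, hqN]; ring
  have hHd : (g - q).natDegree = N :=
    Polynomial.natDegree_eq_of_le_of_coeff_ne_zero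
      ((Polynomial.natDegree_sub_le _ _).trans (by rw [hg]; exact max_le le_rfl hqd))
      (by rw [hHN]; positivity)
  refine ⟨g - q, tendsto_eval_cocompact (fun x => ?_)
    (Polynomial.natDegree_pos_iff_degree_pos.mp (by omega)) ?_, ?_⟩
  · simp [hq, he, hN.neg_pow]
  · rw [Polynomial.leadingCoeff, hHd, hHN]; positivity
  intro f s C hf hs hC hcoef
  have hCpos : 0 < |C| + 1 := by positivity
  refine ⟨min 1 (c / (4 * (|C| + 1))), by positivity, ?_⟩
  have hδ : 0 < min 1 (c / 4) := by positivity
  filter_upwards [hC, hs.eventually_gt_atTop 0,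
    (tendsto_coeffError hcoef).eventually (gt_mem_nhds hδ)] with n hC hs0 hδn x hx
  have hx1 : |x / s n| ≤ 1 := hx.le.trans (min_le_left _ _)
  have hx2 : |x| / s n ≤ c / (4 * (|C| + 1)) := by
    rw [abs_div, abs_of_pos hs0] at hx
    exact hx.le.trans (min_le_right _ _)
  have hxN : x ^ N = |x| ^ N := (hN.pow_abs x).symm
  have hmain := abs_scaled_sub_eval_le (hf n) (Nat.zero_le N) hg.le hC hs0 hx1
    (b := 1 + |x| ^ N) fun i hi => by
      rcases le_total |x| 1 with h | h
      · have := pow_le_one₀ (n := i) (abs_nonneg x) h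
        have := pow_nonneg (abs_nonneg x) N
        linarith
      · have := pow_le_pow_right₀ h (show i ≤ N by omega)
        linarith
  simp only [Nat.sub_zero, iteratedDeriv_zero, Function.iterate_zero, id] at hmain
  have h1 : coeffError (f n) (s n) N g * (1 + |x| ^ N) ≤ 1 + c / 4 * |x| ^ N := by
    have hp := pow_nonneg (abs_nonneg x) N
    have e1 : coeffError (f n) (s n) N g ≤ 1 := hδn.le.trans (min_le_left _ _)
    have e2 : coeffError (f n) (s n) N g ≤ c / 4 := hδn.le.trans (min_le_right _ _)
    have e3 := mul_le_mul_of_nonneg_right e2 hp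
    rw [mul_add, mul_one]
    exact add_le_add e1 e3
  have h2 : C * |x| ^ (N + 1) / s n ≤ c / 4 * |x| ^ N := by
    have hp := pow_nonneg (abs_nonneg x) N
    calc C * |x| ^ (N + 1) / s n ≤ (|C| + 1) * |x| ^ (N + 1) / s n := by
          gcongr; linarith [le_abs_self C]
      _ = (|C| + 1) * (|x| / s n) * |x| ^ N := by rw [pow_succ]; ring
      _ ≤ (|C| + 1) * (c / (4 * (|C| + 1))) * |x| ^ N := by gcongr
      _ = _ := by field_simp
  have h3 := (abs_le.mp hmain).1
  have h4 : (g - q).eval x = g.eval x - 1 - c / 2 * |x| ^ N := by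
    simp [hq, hxN]; ring
  rw [h4]
  linarith

end Scaling

/-! ### Equilibrium macrostates and the magnetization -/

lemma sinh_ratio_lt_one (β t : ℝ) : 2 * Real.sinh t / (Real.exp β + 2 * Real.cosh t) < 1 := by
  have hc := Real.cosh_pos t
  rw [div_lt_one (by positivity)]
  linarith [Real.sinh_lt_cosh t, Real.exp_pos β]

lemma freeEnergy_one_le {β K y : ℝ} (hβ : 0 < β) (hK : 0 < K) (hy : 1 ≤ |y|) :
    freeEnergy β K 1 ≤ freeEnergy β K y := by
  have hmono : MonotoneOn (freeEnergy β K) (Set.Ici 1) := by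
    refine monotoneOn_of_deriv_nonneg (convex_Ici 1)
      (fun y _ => (hasDerivAt_freeEnergy β _ y).continuousAt.continuousWithinAt)
      (fun y _ => (hasDerivAt_freeEnergy β _ y).differentiableAt.differentiableWithinAt)
      fun y hy => ?_
    rw [interior_Ici] at hy
    have hy' : (1 : ℝ) < y := hy
    rw [(hasDerivAt_freeEnergy β _ y).deriv]
    have := sinh_ratio_lt_one β (2 * β * K * y)
    exact mul_nonneg (by positivity) (by linarith)
  rcases le_abs'.mp hy with h | h
  · rw [← freeEnergy_neg β K y]
    exact hmono Set.self_mem_Ici (show (1 : ℝ) ≤ -y by linarith) (by linarith)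
  · exact hmono Set.self_mem_Ici h h

lemma continuous_freeEnergy (β K : ℝ) : Continuous (freeEnergy β K) :=
  continuous_iff_continuousAt.mpr fun x => (hasDerivAt_freeEnergy β K x).continuousAt

lemma macrostates_nonempty {β K : ℝ} (hβ : 0 < β) (hK : 0 < K) : (macrostates β K).Nonempty := by
  obtain ⟨x, hx, hmin⟩ := isCompact_Icc.exists_isMinOn (s := Set.Icc (-1 : ℝ) 1)
    ⟨0, by simp⟩ (continuous_freeEnergy β K).continuousOn
  refine ⟨x, hx, fun y => ?_⟩
  by_cases hy : y ∈ Set.Icc (-1 : ℝ) 1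
  · exact hmin hy
  · have h1 : freeEnergy β K x ≤ freeEnergy β K 1 := hmin (by simp)
    refine h1.trans (freeEnergy_one_le hβ hK ?_)
    by_contra h
    exact hy (abs_le.mp (not_le.mp h).le)

lemma isCompact_macrostates (β K : ℝ) : IsCompact (macrostates β K) := by
  have : macrostates β K = Set.Icc (-1 : ℝ) 1 ∩ ⋂ y, {x | freeEnergy β K x ≤ freeEnergy β K y} := by
    ext x; simp [macrostates]
  rw [this]
  exact isCompact_Icc.inter_right
    (isClosed_iInter fun y => isClosed_le (continuous_freeEnergy β K) continuous_const)

lemma neg_mem_macrostates {β K x : ℝ} (hx : x ∈ macrostates β K) : -x ∈ macrostates β K :=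
  ⟨⟨by linarith [hx.1.2], by linarith [hx.1.1]⟩, fun y => by rw [freeEnergy_neg]; exact hx.2 y⟩

lemma magnetization_mem {β K : ℝ} (hβ : 0 < β) (hK : 0 < K) :
    magnetization β K ∈ macrostates β K :=
  (isCompact_macrostates β K).sSup_mem (macrostates_nonempty hβ hK)

/-- If the free energy takes a negative value, there is phase coexistence. -/
lemma coexistence_of_neg {β K y : ℝ} (hβ : 0 < β) (hK : 0 < K) (hy : freeEnergy β K y < 0) :
    (β, K) ∈ phaseCoexistence ∧ 0 < magnetization β K := by
  have hm := magnetization_mem hβ hK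
  have hne : magnetization β K ≠ 0 := fun h => by
    have := hm.2 y
    rw [h, freeEnergy_zero] at this
    linarith
  have hle : -magnetization β K ≤ magnetization β K :=
    le_csSup (isCompact_macrostates β K).bddAbove (neg_mem_macrostates hm)
  have hpos : 0 < magnetization β K := lt_of_le_of_ne (by linarith) hne.symm
  exact ⟨⟨hβ, hK, _, hm, _, neg_mem_macrostates hm, by linarith⟩, hpos⟩

section Magnetization

variable {β : ℝ} {bs ks s : ℕ → ℝ} {N : ℕ} {g H : Polynomial ℝ} {xbar R : ℝ}

lemma eventually_coexistence (hβ : 0 < β) (hb : Tendsto bs atTop (𝓝 β))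
    (hk : Tendsto ks atTop (𝓝 (Kcurve β)))
    (hunif : ∀ S : Set ℝ, IsCompact S → TendstoUniformlyOn
      (fun n u => s n ^ N * freeEnergy (bs n) (ks n) (u / s n)) (fun u => g.eval u) atTop S)
    (hs : Tendsto s atTop atTop) (hneg : g.eval xbar < 0) :
    ∀ᶠ n in atTop, (bs n, ks n) ∈ phaseCoexistence ∧ 0 < magnetization (bs n) (ks n) ∧
      magnetization (bs n) (ks n) ∈ macrostates (bs n) (ks n) ∧
      freeEnergy (bs n) (ks n) (magnetization (bs n) (ks n)) < 0 := by
  have h1 : ∀ᶠ n in atTop, s n ^ N * freeEnergy (bs n) (ks n) (xbar / s n) < 0 :=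
    ((hunif {xbar} isCompact_singleton).tendsto_at rfl).eventually (gt_mem_nhds hneg)
  filter_upwards [h1, hs.eventually_gt_atTop 0, hb.eventually (lt_mem_nhds hβ),
    hk.eventually (lt_mem_nhds (Kcurve_pos hβ))] with n h1 hs0 hb0 hk0
  have h2 : freeEnergy (bs n) (ks n) (xbar / s n) < 0 :=
    neg_of_mul_neg_right h1 (pow_pos hs0 N).le
  have hm := magnetization_mem hb0 hk0
  exact ⟨(coexistence_of_neg hb0 hk0 h2).1, (coexistence_of_neg hb0 hk0 h2).2, hm,
    (hm.2 _).trans_lt h2⟩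

/-- The magnetization, rescaled, converges to the positive minimum point of the limit polynomial. -/
theorem tendsto_scaled_magnetization (hβ : 0 < β) (hβc : β ≤ betaC)
    (hb : Tendsto bs atTop (𝓝 β)) (hk : Tendsto ks atTop (𝓝 (Kcurve β)))
    (hunif : ∀ S : Set ℝ, IsCompact S → TendstoUniformlyOn
      (fun n u => s n ^ N * freeEnergy (bs n) (ks n) (u / s n)) (fun u => g.eval u) atTop S)
    (hs : Tendsto s atTop atTop) (hH : Tendsto (fun x : ℝ => H.eval x) (cocompact ℝ) atTop)
    (hR : 0 < R) (hlow : ∀ᶠ n in atTop, ∀ x : ℝ, |x / s n| < R →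
      H.eval x ≤ s n ^ N * freeEnergy (bs n) (ks n) (x / s n))
    (hmin : ∀ y, 0 ≤ y → y ≠ xbar → g.eval xbar < g.eval y) (hneg : g.eval xbar < 0) :
    Tendsto (fun n => s n * magnetization (bs n) (ks n)) atTop (𝓝 xbar) := by
  rw [Metric.tendsto_atTop']
  intro ε hε
  obtain ⟨C, hC, hCM⟩ := (hasBasis_cocompact.eventually_iff).mp (hH.eventually_gt_atTop 0)
  obtain ⟨η, hη, hgap⟩ : ∃ η : ℝ, 0 < η ∧ ∀ u ∈ C, 0 ≤ u → ε ≤ |u - xbar| →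
      g.eval xbar + η ≤ g.eval u := by
    have hS : IsCompact (C ∩ {u : ℝ | 0 ≤ u ∧ ε ≤ |u - xbar|}) :=
      hC.inter_right ((isClosed_le continuous_const continuous_id).inter
        (isClosed_le continuous_const (by fun_prop : Continuous fun u : ℝ => |u - xbar|)))
    rcases (C ∩ {u : ℝ | 0 ≤ u ∧ ε ≤ |u - xbar|}).eq_empty_or_nonempty with he | hne
    · exact ⟨1, one_pos, fun u hu h0 h1 =>
        (Set.eq_empty_iff_forall_notMem.mp he u ⟨hu, h0, h1⟩).elim⟩
    obtain ⟨u₀, hu₀, hmin₀⟩ := hS.exists_isMinOn hne g.continuous.continuousOn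
    refine ⟨g.eval u₀ - g.eval xbar, sub_pos.mpr (hmin u₀ hu₀.2.1 fun h => ?_),
      fun u hu h0 h1 => ?_⟩
    · have := hu₀.2.2
      rw [h, sub_self, abs_zero] at this
      linarith
    · have : g.eval u₀ ≤ g.eval u := hmin₀ ⟨hu, h0, h1⟩
      linarith
  have hSR : IsCompact (Set.Icc (-1 : ℝ) 1 ∩ {x | R ≤ |x|}) :=
    isCompact_Icc.inter_right (isClosed_le continuous_const continuous_abs)
  obtain ⟨c, hc, hev⟩ := exists_freeEnergy_gt hβ hβc hSR
    (fun h0 => by have := h0.2; simp at this; linarith)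
  have hev := (hb.prodMk_nhds hk).eventually hev
  have hu1 := Metric.tendstoUniformlyOn_iff.mp
    (hunif (C ∪ {xbar}) (hC.union isCompact_singleton)) (η / 2) (half_pos hη)
  have := (eventually_coexistence hβ hb hk hunif hs hneg).and
    (hev.and (hu1.and (hlow.and (hs.eventually_gt_atTop 0))))
  obtain ⟨n₀, hn₀⟩ := eventually_atTop.mp this
  refine ⟨n₀, fun n hn => ?_⟩
  obtain ⟨⟨-, hpos, hmem, hnegm⟩, hev, hu1, hlow, hs0⟩ := hn₀ n hn.le
  set m := magnetization (bs n) (ks n) with hm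
  have hdiv : s n * m / s n = m := by field_simp
  have hmR : |m| < R := by
    by_contra h
    have := hev m ⟨hmem.1, not_lt.mp h⟩
    linarith
  have hneg' : s n ^ N * freeEnergy (bs n) (ks n) m < 0 :=
    mul_neg_of_pos_of_neg (pow_pos hs0 N) hnegm
  have hmC : s n * m ∈ C := by
    by_contra h
    have h1 := hCM h
    have h2 := hlow (s n * m) (by rw [hdiv]; exact hmR)
    rw [hdiv] at h2
    linarith
  have h1 := hu1 (s n * m) (Or.inl hmC)
  have h2 := hu1 xbar (Or.inr rfl)
  rw [Real.dist_eq, hdiv] at h1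
  rw [Real.dist_eq] at h2
  have h3 : s n ^ N * freeEnergy (bs n) (ks n) m ≤
      s n ^ N * freeEnergy (bs n) (ks n) (xbar / s n) :=
    mul_le_mul_of_nonneg_left (hmem.2 _) (pow_pos hs0 N).le
  rw [Real.dist_eq]
  by_contra h
  have := hgap _ hmC (by positivity) (not_lt.mp h)
  linarith [(abs_lt.mp h1).1, (abs_lt.mp h1).2, (abs_lt.mp h2).1, (abs_lt.mp h2).2]

end Magnetization

/-! ### Taylor coefficients of the free energy -/

lemma contDiff_freeEnergy_right (β K : ℝ) : ContDiff ℝ ∞ (freeEnergy β K) := by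
  have h : ContDiff ℝ ∞ (fun p : (ℝ × ℝ) × ℝ => freeEnergy p.1.1 p.1.2 p.2) :=
    contDiff_freeEnergy.of_le le_top
  exact h.comp (g := fun p : (ℝ × ℝ) × ℝ => freeEnergy p.1.1 p.1.2 p.2)
    (f := fun x : ℝ => ((β, K), x)) (by fun_prop)

lemma continuous_iteratedDeriv_freeEnergy (j : ℕ) :
    Continuous (fun p : (ℝ × ℝ) × ℝ => iteratedDeriv j (freeEnergy p.1.1 p.1.2) p.2) :=
  (contDiff_iteratedDeriv_snd j (F := fun p : (ℝ × ℝ) × ℝ => freeEnergy p.1.1 p.1.2 p.2)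
    (contDiff_freeEnergy.of_le le_top)).continuous

lemma exists_iteratedDeriv_freeEnergy_le (j : ℕ) (p₀ : ℝ × ℝ) :
    ∃ C : ℝ, ∀ᶠ p : ℝ × ℝ in 𝓝 p₀, ∀ x, |x| ≤ 1 →
      |iteratedDeriv j (freeEnergy p.1 p.2) x| ≤ C := by
  have hcont := (continuous_iteratedDeriv_freeEnergy j).abs
  obtain ⟨C, hC⟩ := (isCompact_Icc (a := (-1 : ℝ)) (b := 1)).bddAbove_image
    (f := fun x => |iteratedDeriv j (freeEnergy p₀.1 p₀.2) x|)
    (hcont.comp (by fun_prop : Continuous fun x : ℝ => (p₀, x))).continuousOn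
  refine ⟨C + 1, ?_⟩
  have : ∀ᶠ p : ℝ × ℝ in 𝓝 p₀, ∀ x ∈ Set.Icc (-1 : ℝ) 1,
      |iteratedDeriv j (freeEnergy p.1 p.2) x| < C + 1 := by
    refine isCompact_Icc.eventually_forall_of_forall_eventually fun x hx => ?_
    have h1 : |iteratedDeriv j (freeEnergy p₀.1 p₀.2) x| < C + 1 :=
      (hC ⟨x, hx, rfl⟩).trans_lt (lt_add_one C)
    exact hcont.continuousAt.eventually (gt_mem_nhds h1)
  filter_upwards [this] with p hp x hx
  exact (hp x (abs_le.mp hx)).le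

lemma iteratedDeriv_freeEnergy_odd (β K : ℝ) {l : ℕ} (hl : Odd l) :
    iteratedDeriv l (freeEnergy β K) 0 = 0 := by
  have h := iteratedDeriv_comp_neg l (freeEnergy β K) 0
  simp only [freeEnergy_neg, neg_zero, hl.neg_one_pow, smul_eq_mul] at h
  change iteratedDeriv l (freeEnergy β K) 0 = _ at h
  linarith

section Coefficients

variable (A t : ℝ)

/-- The derivative of the cumulant generating function, as a function of `x` with argument `t x`. -/
noncomputable def tiltMean (x : ℝ) : ℝ :=
  2 * Real.sinh (t * x) / (A + 2 * Real.cosh (t * x))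

/-- The probability weight, up to `A = e ^ β`, of spin zero under the tilted single-site measure. -/
noncomputable def tiltWeight (x : ℝ) : ℝ := 1 / (A + 2 * Real.cosh (t * x))

variable {A}

lemma hasDerivAt_tiltMean (hA : 0 < A) (x : ℝ) : HasDerivAt (tiltMean A t)
    (t * (1 - A * tiltWeight A t x - tiltMean A t x ^ 2)) x := by
  have hc := Real.cosh_pos (t * x)
  have hne : A + 2 * Real.cosh (t * x) ≠ 0 := by positivity
  have h0 : HasDerivAt (fun x : ℝ => t * x) t x := by
    simpa using (hasDerivAt_id x).const_mul t
  have h := ((h0.sinh).const_mul 2).div (((h0.cosh).const_mul 2).const_add A) hne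
  refine h.congr_deriv ?_
  unfold tiltMean tiltWeight
  field_simp
  ring

lemma hasDerivAt_tiltWeight (hA : 0 < A) (x : ℝ) : HasDerivAt (tiltWeight A t)
    (-(t * (tiltWeight A t x * tiltMean A t x))) x := by
  have hc := Real.cosh_pos (t * x)
  have hne : A + 2 * Real.cosh (t * x) ≠ 0 := by positivity
  have h0 : HasDerivAt (fun x : ℝ => t * x) t x := by
    simpa using (hasDerivAt_id x).const_mul t
  have h := (hasDerivAt_const x (1 : ℝ)).div (((h0.cosh).const_mul 2).const_add A) hne
  refine h.congr_deriv ?_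
  unfold tiltMean tiltWeight
  field_simp
  ring

end Coefficients

lemma iteratedDeriv_two_freeEnergy (β K : ℝ) :
    iteratedDeriv 2 (freeEnergy β K) = fun x => 2 * β * K - (2 * β * K) ^ 2 *
      (1 - Real.exp β * tiltWeight (Real.exp β) (2 * β * K) x -
        tiltMean (Real.exp β) (2 * β * K) x ^ 2) := by
  have h1 : deriv (freeEnergy β K) =
      fun x => 2 * β * K * (x - tiltMean (Real.exp β) (2 * β * K) x) :=
    funext fun x => (hasDerivAt_freeEnergy β K x).deriv
  rw [iteratedDeriv_succ, iteratedDeriv_one, h1]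
  funext x
  refine HasDerivAt.deriv ((((hasDerivAt_id x).sub
    (hasDerivAt_tiltMean (2 * β * K) (Real.exp_pos β) x)).const_mul (2 * β * K)).congr_deriv ?_)
  ring

lemma iteratedDeriv_four_freeEnergy (β K : ℝ) :
    iteratedDeriv 4 (freeEnergy β K) = fun x => -((2 * β * K) ^ 4 *
      (-2 + 5 * (Real.exp β * tiltWeight (Real.exp β) (2 * β * K) x) -
        3 * (Real.exp β * tiltWeight (Real.exp β) (2 * β * K) x) ^ 2 +
        8 * tiltMean (Real.exp β) (2 * β * K) x ^ 2 -
        12 * (Real.exp β * tiltWeight (Real.exp β) (2 * β * K) x) *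
          tiltMean (Real.exp β) (2 * β * K) x ^ 2 -
        6 * tiltMean (Real.exp β) (2 * β * K) x ^ 4)) := by
  set t := 2 * β * K
  set A := Real.exp β
  have hv (x : ℝ) := hasDerivAt_tiltMean t (Real.exp_pos β) x
  have hw (x : ℝ) := (hasDerivAt_tiltWeight t (Real.exp_pos β) x).const_mul A
  have h3 : iteratedDeriv 3 (freeEnergy β K) = fun x => -(t ^ 3 *
      (3 * (A * tiltWeight A t x) * tiltMean A t x - 2 * tiltMean A t x +
        2 * tiltMean A t x ^ 3)) := by
    rw [iteratedDeriv_succ, iteratedDeriv_two_freeEnergy]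
    funext x
    refine HasDerivAt.deriv ((((((hw x).const_sub 1).sub ((hv x).pow 2)).const_mul
      (t ^ 2)).const_sub t).congr_deriv ?_)
    simp only [Nat.cast_ofNat, Nat.reduceSub]
    ring
  rw [iteratedDeriv_succ, h3]
  funext x
  refine HasDerivAt.deriv ((((((((hw x).const_mul 3).mul (hv x)).sub ((hv x).const_mul 2)).add
    (((hv x).pow 3).const_mul 2)).const_mul (t ^ 3)).neg).congr_deriv ?_)
  simp only [Nat.cast_ofNat, Nat.reduceSub]
  ring

lemma tiltMean_zero (A t : ℝ) : tiltMean A t 0 = 0 := by simp [tiltMean]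

lemma tiltWeight_zero (A t : ℝ) : tiltWeight A t 0 = 1 / (A + 2) := by simp [tiltWeight]

lemma iteratedDeriv_two_freeEnergy_zero {β : ℝ} (hβ : 0 < β) (K : ℝ) :
    iteratedDeriv 2 (freeEnergy β K) 0 =
      2 * β * K / Kcurve β * (Kcurve β - K) := by
  simp only [iteratedDeriv_two_freeEnergy, tiltMean_zero, tiltWeight_zero, Kcurve]
  have := Real.exp_pos β
  field_simp
  ring

lemma iteratedDeriv_four_freeEnergy_zero (β K : ℝ) :
    iteratedDeriv 4 (freeEnergy β K) 0 =
      (2 * β * K) ^ 4 * (2 * (4 - Real.exp β)) / (Real.exp β + 2) ^ 2 := by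
  simp only [iteratedDeriv_four_freeEnergy, tiltMean_zero, tiltWeight_zero]
  have := Real.exp_pos β
  field_simp
  ring

lemma exp_betaC : Real.exp betaC = 4 := Real.exp_log (by norm_num)

lemma betaC_pos : 0 < betaC := Real.log_pos (by norm_num)

lemma two_mul_Kcurve {β : ℝ} (hβ : 0 < β) : 2 * β * Kcurve β = (Real.exp β + 2) / 2 := by
  unfold Kcurve; field_simp; ring

lemma iteratedDeriv_six_freeEnergy_betaC :
    iteratedDeriv 6 (freeEnergy betaC (Kcurve betaC)) 0 = 162 := by
  have ht : 2 * betaC * Kcurve betaC = 3 := by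
    rw [two_mul_Kcurve betaC_pos, exp_betaC]; norm_num
  have hv (x : ℝ) := hasDerivAt_tiltMean 3 (A := 4) (by norm_num) x
  have hw (x : ℝ) := (hasDerivAt_tiltWeight 3 (A := 4) (by norm_num) x).const_mul 4
  have h5 : iteratedDeriv 5 (freeEnergy betaC (Kcurve betaC)) = fun x => -(3 ^ 5 *
      (16 * tiltMean 4 3 x - 45 * (4 * tiltWeight 4 3 x) * tiltMean 4 3 x +
        30 * (4 * tiltWeight 4 3 x) ^ 2 * tiltMean 4 3 x - 40 * tiltMean 4 3 x ^ 3 +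
        60 * (4 * tiltWeight 4 3 x) * tiltMean 4 3 x ^ 3 + 24 * tiltMean 4 3 x ^ 5)) := by
    rw [iteratedDeriv_succ, iteratedDeriv_four_freeEnergy, ht, exp_betaC]
    funext x
    refine HasDerivAt.deriv (((((((((hw x).const_mul 5).const_add (-2)).sub
      (((hw x).pow 2).const_mul 3)).add (((hv x).pow 2).const_mul 8)).sub
      (((hw x).const_mul 12).mul ((hv x).pow 2))).sub (((hv x).pow 4).const_mul 6)).const_mul
      (3 ^ 4)).neg.congr_deriv ?_)
    simp only [Nat.cast_ofNat, Nat.reduceSub, Pi.pow_apply]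
    ring
  rw [iteratedDeriv_succ, h5]
  have h6 := ((((((((hv 0).const_mul 16).sub (((hw 0).const_mul 45).mul (hv 0))).add
    ((((hw 0).pow 2).const_mul 30).mul (hv 0))).sub (((hv 0).pow 3).const_mul 40)).add
    (((hw 0).const_mul 60).mul ((hv 0).pow 3))).add (((hv 0).pow 5).const_mul 24)).const_mul
    (3 ^ 5)).neg
  refine h6.deriv.trans ?_
  simp only [tiltMean_zero, tiltWeight_zero, Pi.pow_apply]
  norm_num

/-! ### Ginzburg–Landau polynomials -/

/-- The even polynomial `a x² + b x⁴ + c x⁶`. -/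
noncomputable def glPoly (a b c : ℝ) : Polynomial ℝ :=
  Polynomial.C a * Polynomial.X ^ 2 + Polynomial.C b * Polynomial.X ^ 4 +
    Polynomial.C c * Polynomial.X ^ 6

section GLPoly

variable {a b c y : ℝ}

lemma glPoly_eval (a b c x : ℝ) :
    (glPoly a b c).eval x = a * x ^ 2 + b * x ^ 4 + c * x ^ 6 := by
  simp [glPoly]

lemma glPoly_coeff (a b c : ℝ) (l : ℕ) : (glPoly a b c).coeff l =
    (if l = 2 then a else 0) + (if l = 4 then b else 0) + (if l = 6 then c else 0) := by
  simp [glPoly, Polynomial.coeff_X_pow]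

lemma glPoly_natDegree {N : ℕ} (hN : (N = 4 ∧ c = 0 ∧ 0 < b) ∨ (N = 6 ∧ 0 < c)) :
    (glPoly a b c).natDegree = N := by
  rcases hN with ⟨rfl, rfl, hb⟩ | ⟨rfl, hc⟩
  · have h : glPoly a b 0 = Polynomial.C a * Polynomial.X ^ 2 +
        Polynomial.C b * Polynomial.X ^ 4 := by simp [glPoly]
    have h4 : b ≠ 0 := hb.ne'
    rw [h]
    compute_degree!
  · have h6 : c ≠ 0 := hc.ne'
    unfold glPoly
    compute_degree!

lemma glPoly_leadingCoeff_pos {N : ℕ} (hN : (N = 4 ∧ c = 0 ∧ 0 < b) ∨ (N = 6 ∧ 0 < c)) :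
    0 < (glPoly a b c).leadingCoeff := by
  rw [Polynomial.leadingCoeff, glPoly_natDegree hN, glPoly_coeff]
  rcases hN with ⟨rfl, rfl, hb⟩ | ⟨rfl, hc⟩ <;> simpa

/-- Factorization at a double root, in the variable `x²`. -/
lemma glPoly_eval_sub (h1 : 3 * c * y ^ 2 + 2 * b * y + a = 0) (hy : 0 < y) (x : ℝ) :
    (glPoly a b c).eval x - (glPoly a b c).eval (√y) =
      (x ^ 2 - y) ^ 2 * (c * x ^ 2 + (2 * c * y + b)) := by
  have hs : √y ^ 2 = y := Real.sq_sqrt hy.le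
  have e4 : √y ^ 4 = y ^ 2 := by linear_combination (√y ^ 2 + y) * hs
  have e6 : √y ^ 6 = y ^ 3 := by
    linear_combination (√y ^ 4 + √y ^ 2 * y + y ^ 2) * hs
  rw [glPoly_eval, glPoly_eval, hs, e4, e6]
  have ha : a = -(3 * c * y ^ 2 + 2 * b * y) := by linarith
  rw [ha]; ring

lemma glPoly_lt (h1 : 3 * c * y ^ 2 + 2 * b * y + a = 0) (h2 : 0 < 2 * c * y + b) (hc : 0 ≤ c)
    (hy : 0 < y) {x : ℝ} (hx : x ^ 2 ≠ y) :
    (glPoly a b c).eval (√y) < (glPoly a b c).eval x := by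
  rw [← sub_pos, glPoly_eval_sub h1 hy]
  have : 0 < (x ^ 2 - y) ^ 2 := by
    have := sub_ne_zero.mpr hx
    positivity
  positivity

lemma glPoly_minimizers (h1 : 3 * c * y ^ 2 + 2 * b * y + a = 0) (h2 : 0 < 2 * c * y + b)
    (hc : 0 ≤ c) (hy : 0 < y) :
    {x : ℝ | ∀ z : ℝ, (glPoly a b c).eval x ≤ (glPoly a b c).eval z} = {√y, -√y} := by
  have hs : √y ^ 2 = y := Real.sq_sqrt hy.le
  ext x
  simp only [Set.mem_ofPred_eq, Set.mem_insert_iff, Set.mem_singleton_iff]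
  rw [← sq_eq_sq_iff_eq_or_eq_neg, hs]
  constructor
  · intro h
    by_contra hx
    exact absurd (h (√y)) (not_le.mpr (glPoly_lt h1 h2 hc hy hx))
  · intro hx z
    rw [← sub_nonneg]
    have e : (glPoly a b c).eval x = (glPoly a b c).eval (√y) := by
      have := glPoly_eval_sub h1 hy x
      rw [hx, sub_self] at this
      linarith
    rw [e, glPoly_eval_sub h1 hy]
    positivity

lemma glPoly_eval_neg_of (h1 : 3 * c * y ^ 2 + 2 * b * y + a = 0) (h2 : 0 < 2 * c * y + b)
    (hc : 0 ≤ c) (hy : 0 < y) : (glPoly a b c).eval (√y) < 0 := by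
  have := glPoly_lt h1 h2 hc hy (x := 0) (by simpa using hy.ne)
  simpa [glPoly_eval] using this

lemma glPoly_derivative_pos {N : ℕ} (hN : (N = 4 ∧ c = 0 ∧ 0 < b) ∨ (N = 6 ∧ 0 < c))
    (h1 : 3 * c * y ^ 2 + 2 * b * y + a = 0) (h2 : 0 < 2 * c * y + b) (hy : 0 < y)
    {j : ℕ} (hj : j ∈ Finset.Icc 2 N) :
    0 < (Polynomial.derivative^[j] (glPoly a b c)).eval (√y) := by
  have hs : √y ^ 2 = y := Real.sq_sqrt hy.le
  have hs0 : 0 < √y := Real.sqrt_pos.mpr hy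
  have hc : 0 ≤ c := by
    rcases hN with ⟨-, hc, -⟩ | ⟨-, hc⟩
    · exact hc.ge
    · exact hc.le
  have hcy : 0 ≤ c * y := by positivity
  have h6 : (glPoly a b c).natDegree ≤ 6 := by
    rw [glPoly_natDegree hN]; rcases hN with ⟨rfl, -⟩ | ⟨rfl, -⟩ <;> norm_num
  obtain ⟨hj2, hjN⟩ := Finset.mem_Icc.mp hj
  have hj6 : j ≤ 6 := hjN.trans (by rcases hN with ⟨rfl, -⟩ | ⟨rfl, -⟩ <;> norm_num)
  rw [eval_iterate_derivative_eq h6 hj6]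
  simp only [glPoly_coeff]
  interval_cases j
  · simp [Finset.sum_range_succ, Nat.factorial]
    have e4 : √y ^ 4 = y ^ 2 := by linear_combination (√y ^ 2 + y) * hs
    rw [e4, hs]
    have : 0 < y * (c * y + (2 * c * y + b)) := by positivity
    nlinarith
  · simp [Finset.sum_range_succ, Nat.factorial]
    have e3 : √y ^ 3 = √y * y := by linear_combination √y * hs
    rw [e3]
    have : 0 < √y * (3 * (c * y) + (2 * c * y + b)) := by positivity
    nlinarith
  · simp [Finset.sum_range_succ, Nat.factorial]
    rw [hs]
    nlinarith
  all_goals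
    rcases hN with ⟨rfl, -⟩ | ⟨rfl, hc'⟩
    · omega
    · simp [Finset.sum_range_succ, Nat.factorial]
      positivity

/-- A critical point of `a t + b t² + c t³` that is a global minimum on `t ≥ 0`. -/
lemma exists_glPoly_critical (hc : 0 < c) (h : (a < 0 ∧ 0 ≤ b) ∨ (b < 0 ∧ 4 * (a * c) < b ^ 2)) :
    ∃ y : ℝ, 0 < y ∧ 3 * c * y ^ 2 + 2 * b * y + a = 0 ∧ 0 < 2 * c * y + b := by
  have hD : 0 ≤ b ^ 2 - 3 * (a * c) := by
    rcases h with ⟨ha, -⟩ | ⟨hb, hD⟩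
    · nlinarith [sq_nonneg b, mul_pos (neg_pos.mpr ha) hc]
    · nlinarith [sq_nonneg b]
  set r := √(b ^ 2 - 3 * (a * c)) with hr
  have hr2 : r ^ 2 = b ^ 2 - 3 * (a * c) := Real.sq_sqrt hD
  have hr0 : 0 ≤ r := Real.sqrt_nonneg _
  have key : 0 < 2 * r + b ∧ 0 < r - b := by
    rcases h with ⟨ha, hb⟩ | ⟨hb, hD'⟩
    · have hac := mul_pos (neg_pos.mpr ha) hc
      have : b < r := by
        refine lt_of_pow_lt_pow_left₀ 2 hr0 ?_
        rw [hr2]; nlinarith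
      constructor <;> linarith
    · refine ⟨?_, by linarith⟩
      have : -b < 2 * r := by
        refine lt_of_pow_lt_pow_left₀ 2 (by positivity) ?_
        rw [mul_pow, hr2]; nlinarith
      linarith
  refine ⟨(r - b) / (3 * c), div_pos key.2 (by positivity), ?_, ?_⟩
  · field_simp
    nlinarith
  · have : 2 * c * ((r - b) / (3 * c)) + b = (2 * r + b) / 3 := by field_simp; ring
    rw [this]; linarith [key.1]

end GLPoly

/-! ### Verifying the hypotheses through the Taylor coefficients -/

lemma rpow_eq_scale {n : ℕ} (hn : n ≠ 0) {N : ℕ} {θ α α₀ : ℝ} (h0 : 0 < α₀)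
    (hαθ : N * (θ * α₀) = 1) {j : ℕ} (hj : j ≤ N) :
    (n : ℝ) ^ (α / α₀ - j * (θ * α)) = ((n : ℝ) ^ (θ * α)) ^ (N - j) := by
  have hn0 : (0 : ℝ) ≤ n := by positivity
  rw [← Real.rpow_natCast, ← Real.rpow_mul hn0, Nat.cast_sub hj]
  congr 1
  have : α / α₀ = N * (θ * α) := by
    rw [div_eq_iff h0.ne']; linear_combination -α * hαθ
  rw [this]; ring

lemma tendsto_iteratedDeriv_freeEnergy_zero (j : ℕ) {β K : ℝ} {bs ks : ℕ → ℝ}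
    (hb : Tendsto bs atTop (𝓝 β)) (hk : Tendsto ks atTop (𝓝 K)) :
    Tendsto (fun n => iteratedDeriv j (freeEnergy (bs n) (ks n)) 0) atTop
      (𝓝 (iteratedDeriv j (freeEnergy β K) 0)) := by
  have h1 : Tendsto (fun n => ((bs n, ks n), (0 : ℝ))) atTop (𝓝 ((β, K), (0 : ℝ))) :=
    (hb.prodMk_nhds hk).prodMk_nhds tendsto_const_nhds
  have h2 := ((continuous_iteratedDeriv_freeEnergy j).tendsto ((β, K), (0 : ℝ))).comp h1
  simpa only [Function.comp_def] using h2

theorem Hypotheses.of_coefficients {β : ℝ} (hβ : 0 < β) (hβc : β ≤ betaC) {βs Ks : ℝ → ℕ → ℝ}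
    {α₀ θ a b c y : ℝ} {N : ℕ} (hN : (N = 4 ∧ c = 0 ∧ 0 < b) ∨ (N = 6 ∧ 0 < c)) (hy : 0 < y)
    (hcrit : 3 * c * y ^ 2 + 2 * b * y + a = 0) (hmin : 0 < 2 * c * y + b)
    (hα₀ : 0 < α₀) (hθ : 0 < θ) (hαθ : N * (θ * α₀) = 1)
    (hβs : ∀ α, 0 < α → α < α₀ → Tendsto (βs α) atTop (𝓝 β))
    (hKs : ∀ α, 0 < α → α < α₀ → Tendsto (Ks α) atTop (𝓝 (Kcurve β)))
    (hspeed : ∀ α, 0 < α → α < α₀ → ∃ b k : ℝ,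
      Tendsto (fun n : ℕ => (n : ℝ) ^ α * (βs α n - β)) atTop (𝓝 b) ∧
      Tendsto (fun n : ℕ => (n : ℝ) ^ α * (Ks α n - Kcurve β)) atTop (𝓝 k) ∧
      ¬(b = 0 ∧ k = 0) ∧ (b ≠ 0 → b = 1 ∨ b = -1))
    (h2 : ∀ α, 0 < α → α < α₀ → Tendsto (fun n : ℕ => ((n : ℝ) ^ (θ * α)) ^ (N - 2) *
      iteratedDeriv 2 (freeEnergy (βs α n) (Ks α n)) 0) atTop (𝓝 (2 * a)))
    (h4 : ∀ α, 0 < α → α < α₀ → Tendsto (fun n : ℕ => ((n : ℝ) ^ (θ * α)) ^ (N - 4) *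
      iteratedDeriv 4 (freeEnergy (βs α n) (Ks α n)) 0) atTop (𝓝 (24 * b)))
    (h6 : N = 6 → iteratedDeriv 6 (freeEnergy β (Kcurve β)) 0 = 720 * c) :
    Hypotheses β βs Ks (glPoly a b c) α₀ θ (√y) := by
  have hdeg : (glPoly a b c).natDegree = N := glPoly_natDegree hN
  have hlead : 0 < (glPoly a b c).leadingCoeff := glPoly_leadingCoeff_pos hN
  have hc : 0 ≤ c := by
    rcases hN with ⟨-, hc, -⟩ | ⟨-, hc⟩
    · exact hc.ge
    · exact hc.le
  have heven : ∀ x : ℝ, (glPoly a b c).eval (-x) = (glPoly a b c).eval x := fun x => by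
    rw [glPoly_eval, glPoly_eval]; ring
  have hNeven : Even N := by rcases hN with ⟨rfl, -⟩ | ⟨rfl, -⟩ <;> decide
  have hN0 : 0 < N := by rcases hN with ⟨rfl, -⟩ | ⟨rfl, -⟩ <;> norm_num
  have hs : ∀ α, 0 < α → Tendsto (fun n : ℕ => (n : ℝ) ^ (θ * α)) atTop atTop :=
    fun α hα => tendsto_natCast_rpow_atTop (mul_pos hθ hα)
  have hprod : ∀ α, 0 < α → α < α₀ →
      Tendsto (fun n => (βs α n, Ks α n)) atTop (𝓝 (β, Kcurve β)) :=
    fun α hα hα' => (hβs α hα hα').prodMk_nhds (hKs α hα hα')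
  obtain ⟨C, hC⟩ := exists_iteratedDeriv_freeEnergy_le (N + 1) (β, Kcurve β)
  have hC' : ∀ α, 0 < α → α < α₀ → ∀ᶠ n in atTop, ∀ x, |x| ≤ 1 →
      |iteratedDeriv (N + 1) (freeEnergy (βs α n) (Ks α n)) x| ≤ C :=
    fun α hα hα' => (hprod α hα hα').eventually hC
  have hcoef : ∀ α, 0 < α → α < α₀ → ∀ l ≤ N,
      Tendsto (fun n : ℕ => ((n : ℝ) ^ (θ * α)) ^ (N - l) *
        iteratedDeriv l (freeEnergy (βs α n) (Ks α n)) 0) atTop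
        (𝓝 ((l ! : ℝ) * (glPoly a b c).coeff l)) := by
    intro α hα hα' l hl
    have hl6 : l ≤ 6 := hl.trans (by rcases hN with ⟨rfl, -⟩ | ⟨rfl, -⟩ <;> norm_num)
    rw [glPoly_coeff]
    interval_cases l
    · simp
    · simp [iteratedDeriv_freeEnergy_odd _ _ (by decide : Odd 1), -iteratedDeriv_one]
    · simpa [Nat.factorial] using h2 α hα hα'
    · simp [iteratedDeriv_freeEnergy_odd _ _ (by decide : Odd 3)]
    · simpa [Nat.factorial] using h4 α hα hα'
    · simp [iteratedDeriv_freeEnergy_odd _ _ (by decide : Odd 5)]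
    · have hN6 : N = 6 := by
        rcases hN with ⟨rfl, -⟩ | ⟨rfl, -⟩
        · omega
        · rfl
      have hlim : Tendsto (fun n => iteratedDeriv 6 (freeEnergy (βs α n) (Ks α n)) 0) atTop
          (𝓝 (iteratedDeriv 6 (freeEnergy β (Kcurve β)) 0)) :=
        tendsto_iteratedDeriv_freeEnergy_zero 6 (hβs α hα hα') (hKs α hα hα')
      rw [h6 hN6] at hlim
      simpa [hN6, Nat.factorial] using hlim
  have hunif : ∀ α, 0 < α → α < α₀ → ∀ j ≤ N, ∀ S : Set ℝ, IsCompact S →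
      TendstoUniformlyOn (fun (n : ℕ) u => ((n : ℝ) ^ (θ * α)) ^ (N - j) *
        iteratedDeriv j (freeEnergy (βs α n) (Ks α n)) (u / (n : ℝ) ^ (θ * α)))
        (fun u => (Polynomial.derivative^[j] (glPoly a b c)).eval u) atTop S :=
    fun α hα hα' j hj S hS => tendstoUniformlyOn_scaled
      (fun n => contDiff_freeEnergy_right _ _) (hs α hα) (hC' α hα hα') hdeg.le
      (hcoef α hα hα') hj hS
  have hunif0 : ∀ α, 0 < α → α < α₀ → ∀ S : Set ℝ, IsCompact S →
      TendstoUniformlyOn (fun (n : ℕ) u => ((n : ℝ) ^ (θ * α)) ^ N *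
        freeEnergy (βs α n) (Ks α n) (u / (n : ℝ) ^ (θ * α)))
        (fun u => (glPoly a b c).eval u) atTop S := fun α hα hα' S hS => by
    simpa using hunif α hα hα' 0 (Nat.zero_le N) S hS
  have hneg := glPoly_eval_neg_of hcrit hmin hc hy
  obtain ⟨H, hH, hlow⟩ := exists_scaled_lower_bound hNeven hN0 hdeg heven hlead
  have hlow' := fun α (hα : 0 < α) (hα' : α < α₀) => hlow
    (fun n => freeEnergy (βs α n) (Ks α n)) _ C (fun n => contDiff_freeEnergy_right _ _)
    (hs α hα) (hC' α hα hα') (hcoef α hα hα')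
  have hscale : ∀ α : ℝ, ∀ n : ℕ, n ≠ 0 → (n : ℝ) ^ (α / α₀) = ((n : ℝ) ^ (θ * α)) ^ N :=
    fun α n hn => by
      have := rpow_eq_scale (α := α) hn hα₀ hαθ (Nat.zero_le N)
      simpa using this
  refine
    { beta_pos := hβ
      beta_le := hβc
      alpha₀_pos := hα₀
      theta_pos := hθ
      tendsto_beta := hβs
      tendsto_K := hKs
      coexistence := fun α hα hα' => ?_
      speed := hspeed
      g_even := heven
      g_degree := ?_
      g_coercive := tendsto_eval_cocompact heven
        (Polynomial.natDegree_pos_iff_degree_pos.mp (by omega)) hlead.le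
      tendsto_g := fun α hα hα' S hS => ?_
      xbar_pos := Real.sqrt_pos.mpr hy
      g_minimizers := glPoly_minimizers hcrit hmin hc hy
      lower_bound := ⟨H, hH, fun α hα hα' => ?_⟩
      range_four := fun h => ?_
      range_six := fun h => ?_
      deriv_pos := fun j hj => glPoly_derivative_pos hN hcrit hmin hy (by rwa [hdeg] at hj)
      tendsto_deriv := fun α hα hα' j hj => ?_ }
  · filter_upwards [eventually_coexistence hβ (hβs α hα hα') (hKs α hα hα')
      (hunif0 α hα hα') (hs α hα) hneg] with n hn
    exact hn.1
  · rw [hdeg]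
    rcases hN with ⟨rfl, -⟩ | ⟨rfl, -⟩ <;> simp
  · refine (hunif0 α hα hα' S hS).congr ?_
    filter_upwards [eventually_ne_atTop 0] with n hn x _
    simp only [hscale α n hn]
  · obtain ⟨R, hR, hev⟩ := hlow' α hα hα'
    refine ⟨R, hR, ?_⟩
    filter_upwards [hev, eventually_ne_atTop 0] with n hn hn0 x hx
    rw [hscale α n hn0]
    exact hn x hx
  · have h' : N = 4 := hdeg.symm.trans h
    subst h'
    push_cast at hαθ
    constructor <;> linarith
  · have h' : N = 6 := hdeg.symm.trans h
    subst h'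
    push_cast at hαθ
    constructor <;> linarith
  · rw [hdeg] at hj
    have hjN := (Finset.mem_Icc.mp hj).2
    obtain ⟨R, hR, hev⟩ := hlow' α hα hα'
    have hm := tendsto_scaled_magnetization hβ hβc (hβs α hα hα') (hKs α hα hα')
      (hunif0 α hα hα') (hs α hα) hH hR hev
      (fun z hz hne => glPoly_lt hcrit hmin hc hy fun h => hne (by
        rw [← h, Real.sqrt_sq hz])) hneg
    have hcompact := hunif α hα hα' j hjN (Metric.closedBall (√y) 1) (isCompact_closedBall _ _)
    have hlim : Tendsto (fun n : ℕ => ((n : ℝ) ^ (θ * α)) ^ (N - j) *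
        iteratedDeriv j (freeEnergy (βs α n) (Ks α n))
          ((n : ℝ) ^ (θ * α) * magnetization (βs α n) (Ks α n) / (n : ℝ) ^ (θ * α))) atTop
        (𝓝 ((Polynomial.derivative^[j] (glPoly a b c)).eval (√y))) :=
      hcompact.tendsto_comp (Polynomial.continuous _).continuousWithinAt
        (tendsto_nhdsWithin_iff.mpr ⟨hm, hm.eventually (Metric.closedBall_mem_nhds _ one_pos)⟩)
    refine hlim.congr' ?_
    filter_upwards [eventually_ne_atTop 0] with n hn
    have hn0 : (0 : ℝ) < n := by positivity
    rw [rpow_eq_scale hn hα₀ hαθ hjN, mul_div_cancel_left₀ _ (by positivity)]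

/-! ### Expansions along the parameter sequences -/

lemma contDiffOn_Kcurve : ContDiffOn ℝ ∞ Kcurve (Set.Ioi 0) := by
  unfold Kcurve
  refine ContDiffOn.div (by fun_prop) (by fun_prop) fun x hx => ?_
  have : (0 : ℝ) < x := hx
  positivity

lemma hasDerivAt_Kcurve {β : ℝ} (hβ : 0 < β) : HasDerivAt Kcurve (deriv Kcurve β) β :=
  ((contDiffOn_Kcurve.contDiffAt (Ioi_mem_nhds hβ)).differentiableAt (by simp)).hasDerivAt

section Sequences

variable {x : ℕ → ℝ}

lemma tendsto_mul_sub_of_hasDerivAt {f : ℝ → ℝ} {f' β : ℝ} (hf : HasDerivAt f f' β)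
    (hx : Tendsto x atTop atTop) (b : ℝ) :
    Tendsto (fun n => x n * (f (β + b / x n) - f β)) atTop (𝓝 (f' * b)) := by
  have h0 : HasDerivAt (fun t => f (β + b * t)) (f' * b) 0 := by
    have h1 : HasDerivAt (fun t : ℝ => β + b * t) b 0 := by
      simpa using ((hasDerivAt_id (0 : ℝ)).const_mul b).const_add β
    have hf' : HasDerivAt f f' (β + b * 0) := by simpa using hf
    exact hf'.comp 0 h1
  have ht : Tendsto (fun n => (x n)⁻¹) atTop (𝓝[≠] 0) :=
    tendsto_nhdsWithin_iff.mpr ⟨tendsto_inv_atTop_zero.comp hx, by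
      filter_upwards [hx.eventually_gt_atTop 0] with n hn
      exact inv_ne_zero hn.ne'⟩
  have := h0.tendsto_slope_zero.comp ht
  refine this.congr fun n => ?_
  simp [div_eq_mul_inv]

lemma tendsto_add_div (β b : ℝ) (hx : Tendsto x atTop atTop) :
    Tendsto (fun n => β + b / x n) atTop (𝓝 β) := by
  simpa using (hx.const_div_atTop b).const_add β

lemma tendsto_mul_add_div_sub (β b : ℝ) (hx : Tendsto x atTop atTop) :
    Tendsto (fun n => x n * (β + b / x n - β)) atTop (𝓝 b) := by
  refine tendsto_const_nhds.congr' ?_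
  filter_upwards [hx.eventually_gt_atTop 0] with n hn
  field_simp
  ring

lemma tendsto_of_tendsto_mul_sub {y : ℕ → ℝ} {l k : ℝ} (hx : Tendsto x atTop atTop)
    (h : Tendsto (fun n => x n * (y n - l)) atTop (𝓝 k)) : Tendsto y atTop (𝓝 l) := by
  have h1 : Tendsto (fun n => (x n * (y n - l)) / x n + l) atTop (𝓝 (0 + l)) :=
    (h.div_atTop hx).add_const l
  rw [zero_add] at h1
  refine h1.congr' ?_
  filter_upwards [hx.eventually_gt_atTop 0] with n hn
  field_simp
  ring

/-- Taylor expansion of `K(β)` along `β + b / x`, `x → ∞`. -/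
lemma tendsto_Kcurve_taylor {β : ℝ} (hβ : 0 < β) (b : ℝ) (p : ℕ) (hx : Tendsto x atTop atTop) :
    Tendsto (fun n => x n ^ p * (Kcurve (β + b / x n) -
      ∑ i ∈ Finset.range (p + 1), iteratedDeriv i Kcurve β * (b / x n) ^ i / (i ! : ℝ)))
      atTop (𝓝 0) := by
  have hmem : ∀ z : ℝ, |z - β| ≤ β / 2 → z ∈ Set.Ioi (0 : ℝ) := fun z hz => by
    have := (abs_le.mp hz).1
    exact (by linarith : (0 : ℝ) < z)
  have hcd := fun k => ContDiffOn.iteratedDeriv_of_isOpen isOpen_Ioi contDiffOn_Kcurve k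
  obtain ⟨C, hC⟩ := (isCompact_closedBall β (β / 2)).exists_bound_of_continuousOn
    (f := iteratedDeriv (p + 1) Kcurve)
    ((hcd (p + 1)).continuousOn.mono fun z hz => hmem z (by simpa [Real.dist_eq] using hz))
  have htaylor := abs_sub_taylor_le (a := β) (r := β / 2) (C := C) (p + 1) (f := Kcurve)
    (fun i _ z hz => ((hcd i).contDiffAt (Ioi_mem_nhds (hmem z hz))).differentiableAt (by simp))
    (fun z hz => hC z (by simpa [Real.dist_eq] using hz))
  have hb0 : Tendsto (fun n => b / x n) atTop (𝓝 0) := hx.const_div_atTop b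
  refine squeeze_zero_norm' (a := fun n => C * |b| ^ (p + 1) / x n) ?_ (hx.const_div_atTop _)
  have hsmall := hb0.abs
  rw [abs_zero] at hsmall
  filter_upwards [hx.eventually_gt_atTop 0,
    hsmall.eventually (ge_mem_nhds (half_pos hβ))] with n hn hb
  have h1 := htaylor (β + b / x n) (by simpa using hb)
  simp only [add_sub_cancel_left] at h1
  rw [Real.norm_eq_abs, abs_mul, abs_of_pos (pow_pos hn p)]
  refine (mul_le_mul_of_nonneg_left h1 (pow_pos hn p).le).trans_eq ?_
  rw [abs_div, abs_of_pos hn, div_pow, pow_succ (x n)]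
  field_simp

lemma tendsto_Kcurve_sub_taylor {β : ℝ} (hβ : 0 < β) (b l : ℝ) (p : ℕ)
    (hx : Tendsto x atTop atTop) :
    Tendsto (fun n => x n ^ p * (Kcurve (β + b / x n) -
      (∑ i ∈ Finset.range p, iteratedDeriv i Kcurve β * (b / x n) ^ i / (i ! : ℝ) +
        l * (b / x n) ^ p / (p ! : ℝ)))) atTop
      (𝓝 ((iteratedDeriv p Kcurve β - l) * b ^ p / (p ! : ℝ))) := by
  have h := (tendsto_Kcurve_taylor hβ b p hx).add_const
    ((iteratedDeriv p Kcurve β - l) * b ^ p / (p ! : ℝ))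
  rw [zero_add] at h
  refine h.congr' ?_
  filter_upwards [hx.eventually_gt_atTop 0] with n hn
  rw [Finset.sum_range_succ, div_pow]
  have : (p ! : ℝ) ≠ 0 := by positivity
  field_simp
  ring

/-- A sequence that agrees with `K(β_n)` to at least second order approaches `K(β)` with the slope of
the second-order curve. -/
lemma tendsto_mul_sub_Kcurve {β b L : ℝ} (hβ : 0 < β) {p : ℕ} (hp : 2 ≤ p)
    (hx : Tendsto x atTop atTop) {k : ℕ → ℝ}
    (h : Tendsto (fun n => x n ^ p * (Kcurve (β + b / x n) - k n)) atTop (𝓝 L)) :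
    Tendsto (fun n => x n * (k n - Kcurve β)) atTop (𝓝 (deriv Kcurve β * b)) := by
  have h1 := tendsto_mul_sub_of_hasDerivAt (hasDerivAt_Kcurve hβ) hx b
  have h2 := h.div_atTop ((tendsto_pow_atTop (show p - 1 ≠ 0 by omega)).comp hx)
  have h3 := h1.sub h2
  rw [sub_zero] at h3
  refine h3.congr' ?_
  filter_upwards [hx.eventually_gt_atTop 0] with n hn
  have hpow : x n ^ p = x n ^ (p - 1) * x n := by
    rw [← pow_succ]; congr 1; omega
  simp only [Function.comp_apply]
  rw [hpow]
  field_simp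
  ring

lemma tendsto_mul_iteratedDeriv_two {β L : ℝ} (hβ : 0 < β) {bs ks q : ℕ → ℝ}
    (hb : Tendsto bs atTop (𝓝 β)) (hk : Tendsto ks atTop (𝓝 (Kcurve β)))
    (h : Tendsto (fun n => q n * (Kcurve (bs n) - ks n)) atTop (𝓝 L)) :
    Tendsto (fun n => q n * iteratedDeriv 2 (freeEnergy (bs n) (ks n)) 0) atTop
      (𝓝 (2 * (β * L))) := by
  have hK := Kcurve_pos hβ
  have hKb : Tendsto (fun n => Kcurve (bs n)) atTop (𝓝 (Kcurve β)) :=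
    (hasDerivAt_Kcurve hβ).continuousAt.tendsto.comp hb
  have h1 := ((((hb.const_mul 2).mul hk).div hKb hK.ne')).mul h
  have e : 2 * β * Kcurve β / Kcurve β * L = 2 * (β * L) := by field_simp
  rw [e] at h1
  refine h1.congr' ?_
  filter_upwards [hb.eventually (lt_mem_nhds hβ)] with n hn
  rw [iteratedDeriv_two_freeEnergy_zero hn]
  simp only [Pi.div_apply]
  ring

lemma tendsto_mul_iteratedDeriv_four_betaC {L : ℝ} {bs ks q : ℕ → ℝ}
    (hb : Tendsto bs atTop (𝓝 betaC)) (hk : Tendsto ks atTop (𝓝 (Kcurve betaC)))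
    (h : Tendsto (fun n => q n * (Real.exp (bs n) - 4)) atTop (𝓝 L)) :
    Tendsto (fun n => q n * iteratedDeriv 4 (freeEnergy (bs n) (ks n)) 0) atTop
      (𝓝 (24 * (-(3 / 16) * L))) := by
  have he : Tendsto (fun n => Real.exp (bs n)) atTop (𝓝 4) := by
    have := (Real.continuous_exp.tendsto betaC).comp hb
    rwa [exp_betaC] at this
  have ht : 2 * betaC * Kcurve betaC = 3 := by
    rw [two_mul_Kcurve betaC_pos, exp_betaC]; norm_num
  have h1 := (((((hb.const_mul 2).mul hk).pow 4).mul_const 2).div ((he.add_const 2).pow 2)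
    (by norm_num)).mul h.neg
  rw [ht] at h1
  have e : (3 : ℝ) ^ 4 * 2 / (4 + 2) ^ 2 * -L = 24 * (-(3 / 16) * L) := by ring
  rw [e] at h1
  refine h1.congr fun n => ?_
  rw [iteratedDeriv_four_freeEnergy_zero]
  simp only [Pi.div_apply]
  ring

end Sequences

lemma rpow_pow_eq (n k q : ℕ) {θ α : ℝ} (h : θ * k = q) :
    ((n : ℝ) ^ (θ * α)) ^ k = ((n : ℝ) ^ α) ^ q := by
  have hn : (0 : ℝ) ≤ n := by positivity
  rw [← Real.rpow_natCast, ← Real.rpow_natCast, ← Real.rpow_mul hn, ← Real.rpow_mul hn, ← h]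
  congr 1; ring

lemma KTaylor_eq {p : ℕ} (hp : 1 ≤ p) (β b l α : ℝ) (n : ℕ) :
    KTaylor β b p l α n =
      ∑ i ∈ Finset.range p, iteratedDeriv i Kcurve β * (b / (n : ℝ) ^ α) ^ i / (i ! : ℝ) +
        l * (b / (n : ℝ) ^ α) ^ p / (p ! : ℝ) := by
  have hpow (j : ℕ) : (n : ℝ) ^ ((j : ℝ) * α) = ((n : ℝ) ^ α) ^ j := by
    rw [mul_comm, Real.rpow_mul_natCast (by positivity)]
  have hterm (c : ℝ) (j : ℕ) : c * b ^ j / ((j ! : ℝ) * (n : ℝ) ^ ((j : ℝ) * α)) =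
      c * (b / (n : ℝ) ^ α) ^ j / (j ! : ℝ) := by
    rw [hpow, div_pow, mul_comm (j ! : ℝ), ← div_div, mul_div_assoc c]
  unfold KTaylor
  simp only [hterm]
  rw [Finset.range_eq_Ico, Finset.sum_eq_sum_Ico_succ_bot (by omega : 0 < p)]
  simp

lemma tendsto_betaRay (β b : ℝ) {α : ℝ} (hα : 0 < α) :
    Tendsto (betaRay β b α) atTop (𝓝 β) :=
  tendsto_add_div β b (tendsto_natCast_rpow_atTop hα)

lemma tendsto_mul_betaRay_sub (β b : ℝ) {α : ℝ} (hα : 0 < α) :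
    Tendsto (fun n : ℕ => (n : ℝ) ^ α * (betaRay β b α n - β)) atTop (𝓝 b) :=
  tendsto_mul_add_div_sub β b (tendsto_natCast_rpow_atTop hα)

/-- The hypotheses at a second-order point. -/
lemma exists_hypotheses_of_lt {β b L α₀ θ : ℝ} {Ks : ℝ → ℕ → ℝ} (hβ : 0 < β) (hβc : β < betaC)
    (hb : b = 1 ∨ b = 0 ∨ b = -1) (hα₀ : 0 < α₀) (hθ : 0 < θ) (hαθ : 4 * (θ * α₀) = 1)
    (hL : L < 0) {k : ℝ} (hbk : ¬(b = 0 ∧ k = 0))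
    (hk : ∀ α, 0 < α → Tendsto (fun n : ℕ => (n : ℝ) ^ α * (Ks α n - Kcurve β)) atTop (𝓝 k))
    (hlim : ∀ α, 0 < α → Tendsto (fun n : ℕ => ((n : ℝ) ^ (θ * α)) ^ 2 *
      (Kcurve (betaRay β b α n) - Ks α n)) atTop (𝓝 L)) :
    ∃ (g : Polynomial ℝ) (xbar : ℝ), Hypotheses β (betaRay β b) Ks g α₀ θ xbar := by
  have hA : Real.exp β < 4 := by rw [← exp_betaC]; exact Real.exp_lt_exp.mpr hβc
  have hK : ∀ α, 0 < α → Tendsto (Ks α) atTop (𝓝 (Kcurve β)) := fun α hα =>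
    tendsto_of_tendsto_mul_sub (tendsto_natCast_rpow_atTop hα) (hk α hα)
  set c₄ := (Real.exp β + 2) ^ 2 * (4 - Real.exp β) / 192 with hc₄
  have hc₄0 : 0 < c₄ := by
    have := sub_pos.mpr hA
    positivity
  have hβL : β * L < 0 := mul_neg_of_pos_of_neg hβ hL
  refine ⟨glPoly (β * L) c₄ 0, _, Hypotheses.of_coefficients hβ hβc.le (N := 4)
    (y := -(β * L) / (2 * c₄)) (Or.inl ⟨rfl, rfl, hc₄0⟩) (div_pos (by linarith) (by positivity))
    (by field_simp; ring) (by simpa using hc₄0) hα₀ hθ (by exact_mod_cast hαθ)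
    (fun α hα _ => tendsto_betaRay β b hα) (fun α hα _ => hK α hα)
    (fun α hα _ => ⟨b, k, tendsto_mul_betaRay_sub β b hα, hk α hα, hbk, fun h0 => by tauto⟩)
    (fun α hα _ => tendsto_mul_iteratedDeriv_two hβ (tendsto_betaRay β b hα) (hK α hα)
      (hlim α hα))
    (fun α hα _ => ?_) (by norm_num)⟩
  have h := tendsto_iteratedDeriv_freeEnergy_zero 4 (tendsto_betaRay β b hα) (hK α hα)
  rw [iteratedDeriv_four_freeEnergy_zero, two_mul_Kcurve hβ] at h
  have e : ((Real.exp β + 2) / 2) ^ 4 * (2 * (4 - Real.exp β)) / (Real.exp β + 2) ^ 2 =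
      24 * c₄ := by
    have := Real.exp_pos β
    rw [hc₄]; field_simp; ring
  rw [e] at h
  simpa using h

/-- The hypotheses at the tricritical point. -/
lemma exists_hypotheses_betaC {b L M α₀ θ : ℝ} {Ks : ℝ → ℕ → ℝ}
    (hb : b = 1 ∨ b = 0 ∨ b = -1) (hα₀ : 0 < α₀) (hθ : 0 < θ) (hαθ : 6 * (θ * α₀) = 1)
    (hLM : (betaC * L < 0 ∧ M ≤ 0) ∨ (0 < M ∧ betaC * L < (5 / 128) * M ^ 2))
    {k : ℝ} (hbk : ¬(b = 0 ∧ k = 0))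
    (hk : ∀ α, 0 < α → Tendsto (fun n : ℕ => (n : ℝ) ^ α * (Ks α n - Kcurve betaC)) atTop (𝓝 k))
    (hlim : ∀ α, 0 < α → Tendsto (fun n : ℕ => ((n : ℝ) ^ (θ * α)) ^ 4 *
      (Kcurve (betaRay betaC b α n) - Ks α n)) atTop (𝓝 L))
    (hlim' : ∀ α, 0 < α → Tendsto (fun n : ℕ => ((n : ℝ) ^ (θ * α)) ^ 2 *
      (Real.exp (betaRay betaC b α n) - 4)) atTop (𝓝 M)) :
    ∃ (g : Polynomial ℝ) (xbar : ℝ), Hypotheses betaC (betaRay betaC b) Ks g α₀ θ xbar := by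
  have hK : ∀ α, 0 < α → Tendsto (Ks α) atTop (𝓝 (Kcurve betaC)) := fun α hα =>
    tendsto_of_tendsto_mul_sub (tendsto_natCast_rpow_atTop hα) (hk α hα)
  obtain ⟨y, hy, hcrit, hmin⟩ := exists_glPoly_critical (a := betaC * L) (b := -(3 / 16) * M)
    (c := 9 / 40) (by norm_num) (by
      rcases hLM with ⟨h1, h2⟩ | ⟨h1, h2⟩
      · exact Or.inl ⟨h1, by linarith⟩
      · exact Or.inr ⟨by linarith, by nlinarith⟩)
  exact ⟨glPoly (betaC * L) (-(3 / 16) * M) (9 / 40), _, Hypotheses.of_coefficients betaC_pos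
    le_rfl (N := 6) (Or.inr ⟨rfl, by norm_num⟩) hy hcrit hmin hα₀ hθ (by exact_mod_cast hαθ)
    (fun α hα _ => tendsto_betaRay betaC b hα) (fun α hα _ => hK α hα)
    (fun α hα _ => ⟨b, k, tendsto_mul_betaRay_sub betaC b hα, hk α hα, hbk, fun h0 => by tauto⟩)
    (fun α hα _ => tendsto_mul_iteratedDeriv_two betaC_pos (tendsto_betaRay betaC b hα) (hK α hα)
      (hlim α hα))
    (fun α hα _ => tendsto_mul_iteratedDeriv_four_betaC (tendsto_betaRay betaC b hα) (hK α hα)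
      (hlim' α hα))
    (fun _ => by rw [iteratedDeriv_six_freeEnergy_betaC]; norm_num)⟩

lemma tendsto_mul_exp_betaRay_sub (b : ℝ) {α : ℝ} (hα : 0 < α) :
    Tendsto (fun n : ℕ => (n : ℝ) ^ α * (Real.exp (betaRay betaC b α n) - 4)) atTop
      (𝓝 (4 * b)) := by
  have := tendsto_mul_sub_of_hasDerivAt (Real.hasDerivAt_exp betaC)
    (tendsto_natCast_rpow_atTop hα) b
  rwa [exp_betaC] at this

lemma tendsto_mul_Kcurve_sub_KRay {β : ℝ} (hβ : 0 < β) (b k : ℝ) {α : ℝ} (hα : 0 < α) :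
    Tendsto (fun n : ℕ => (n : ℝ) ^ α * (Kcurve (betaRay β b α n) - KRay β k α n)) atTop
      (𝓝 (deriv Kcurve β * b - k)) := by
  have hx := tendsto_natCast_rpow_atTop hα
  refine ((tendsto_mul_sub_of_hasDerivAt (hasDerivAt_Kcurve hβ) hx b).sub
    (tendsto_mul_add_div_sub (Kcurve β) k hx)).congr fun n => ?_
  unfold betaRay KRay
  ring

lemma tendsto_mul_Kcurve_sub_KTaylor {β : ℝ} (hβ : 0 < β) (b l : ℝ) {p : ℕ} (hp : 1 ≤ p)
    {α : ℝ} (hα : 0 < α) :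
    Tendsto (fun n : ℕ => ((n : ℝ) ^ α) ^ p *
      (Kcurve (betaRay β b α n) - KTaylor β b p l α n)) atTop
      (𝓝 ((iteratedDeriv p Kcurve β - l) * b ^ p / (p ! : ℝ))) := by
  simp only [KTaylor_eq hp]
  exact tendsto_Kcurve_sub_taylor hβ b l p (tendsto_natCast_rpow_atTop hα)

lemma KLeft_eq (l α : ℝ) (n : ℕ) : KLeft l α n = KTaylor betaC (-1) 2 l α n := by
  simp [KLeft, KTaylor, iteratedDeriv_one]
  ring

lemma KRight_eq (l l' α : ℝ) (n : ℕ) :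
    KRight l l' α n = KTaylor betaC 1 2 l α n + l' / 6 / ((n : ℝ) ^ α) ^ 3 := by
  have h3 : (n : ℝ) ^ (3 * α) = ((n : ℝ) ^ α) ^ 3 := by
    rw [mul_comm]; exact_mod_cast Real.rpow_mul_natCast (by positivity) α 3
  simp [KRight, KTaylor, iteratedDeriv_one, h3, div_div]

lemma tendsto_mul_Kcurve_sub_KRight (l l' : ℝ) {α : ℝ} (hα : 0 < α) :
    Tendsto (fun n : ℕ => ((n : ℝ) ^ α) ^ 2 *
      (Kcurve (betaRay betaC 1 α n) - KRight l l' α n)) atTop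
      (𝓝 ((iteratedDeriv 2 Kcurve betaC - l) * 1 ^ 2 / (2 ! : ℝ))) := by
  have hx := tendsto_natCast_rpow_atTop hα
  have h := (tendsto_mul_Kcurve_sub_KTaylor betaC_pos 1 l one_le_two hα).sub
    (hx.const_div_atTop (l' / 6))
  rw [sub_zero] at h
  refine h.congr' ?_
  filter_upwards [hx.eventually_gt_atTop 0] with n hn
  rw [KRight_eq]
  field_simp
  ring

end BlumeCapel

theorem theorem6p2 :
    -- the moderate deviation principle
    (∀ (β : ℝ) (βs Ks : ℝ → ℕ → ℝ) (g : Polynomial ℝ) (α₀ θ xbar : ℝ),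
      Hypotheses β βs Ks g α₀ θ xbar →
      ∀ α : ℝ, 0 < α → α < α₀ →
        SatisfiesMDP
          (fun n => gibbs n (βs α n) (Ks α n))
          (fun n ω => totalSpin n ω / (n : ℝ) ^ (1 - θ * α))
          (fun n => (n : ℝ) ^ (1 - α / α₀))
          (fun x => g.eval x - ⨅ y : ℝ, g.eval y)) ∧
    -- the hypotheses hold for sequence 1a
    (∀ β b k : ℝ, 0 < β → β < betaC → (b = 1 ∨ b = 0 ∨ b = -1) → k ≠ 0 →
      deriv Kcurve β * b - k < 0 →
      ∃ (g : Polynomial ℝ) (xbar : ℝ),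
        Hypotheses β (betaRay β b) (KRay β k) g (1 / 2) (1 / 2) xbar) ∧
    -- for sequence 2a
    (∀ (β b l : ℝ) (p : ℕ), 0 < β → β < betaC → (b = 1 ∨ b = -1) → 2 ≤ p →
      (iteratedDeriv p Kcurve β - l) * b ^ p < 0 →
      ∃ (g : Polynomial ℝ) (xbar : ℝ),
        Hypotheses β (betaRay β b) (KTaylor β b p l) g (1 / (2 * p)) (p / 2) xbar) ∧
    -- for sequence 3a
    (∀ b k : ℝ, (b = 1 ∨ b = 0 ∨ b = -1) → k ≠ 0 →
      deriv Kcurve betaC * b - k < 0 →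
      ∃ (g : Polynomial ℝ) (xbar : ℝ),
        Hypotheses betaC (betaRay betaC b) (KRay betaC k) g (2 / 3) (1 / 4) xbar) ∧
    -- for sequence 4a
    (∀ l l' : ℝ, iteratedDeriv 2 Kcurve betaC - 5 / (4 * betaC) < l →
      ∃ (g : Polynomial ℝ) (xbar : ℝ),
        Hypotheses betaC (betaRay betaC 1) (KRight l l') g (1 / 3) (1 / 2) xbar) ∧
    -- and for sequence 5a
    (∀ l : ℝ, iteratedDeriv 2 Kcurve betaC < l →
      ∃ (g : Polynomial ℝ) (xbar : ℝ),
        Hypotheses betaC (betaRay betaC (-1)) (KLeft l) g (1 / 3) (1 / 2) xbar) := by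
  refine ⟨fun β βs Ks g α₀ θ xbar h α hα hα' => h.satisfiesMDP hα hα', ?_, ?_, ?_, ?_, ?_⟩
  · intro β b k hβ hβc hb hk hneg
    refine exists_hypotheses_of_lt hβ hβc hb (by norm_num) (by norm_num) (by norm_num) hneg
      (k := k) (fun h => hk h.2)
      (fun α hα => tendsto_mul_add_div_sub _ k (tendsto_natCast_rpow_atTop hα))
      fun α hα => ?_
    simp only [rpow_pow_eq _ 2 1 (show (1 / 2 : ℝ) * (2 : ℕ) = (1 : ℕ) by norm_num), pow_one]
    exact tendsto_mul_Kcurve_sub_KRay hβ b k hα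
  · intro β b l p hβ hβc hb hp hneg
    have hp0 : (0 : ℝ) < p := by exact_mod_cast (by omega : 0 < p)
    have hlim := fun α (hα : 0 < α) =>
      tendsto_mul_Kcurve_sub_KTaylor hβ b l (show 1 ≤ p by omega) hα
    refine exists_hypotheses_of_lt (L := (iteratedDeriv p Kcurve β - l) * b ^ p / p.factorial)
      hβ hβc (by tauto) (by positivity) (by positivity)
      (by field_simp; norm_num) (div_neg_of_neg_of_pos hneg (by positivity))
      (k := deriv Kcurve β * b) (fun h => ?_)
      (fun α hα => tendsto_mul_sub_Kcurve hβ hp (tendsto_natCast_rpow_atTop hα) (hlim α hα))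
      fun α hα => ?_
    · rcases hb with hb | hb <;> norm_num [hb] at h
    · simp only [rpow_pow_eq _ 2 p (show ((p : ℝ) / 2) * (2 : ℕ) = p by push_cast; ring)]
      exact hlim α hα
  · intro b k hb hk hneg
    refine exists_hypotheses_betaC (M := 0) hb (by norm_num) (by norm_num) (by norm_num)
      (Or.inl ⟨mul_neg_of_pos_of_neg betaC_pos hneg, le_rfl⟩) (k := k) (fun h => hk h.2)
      (fun α hα => tendsto_mul_add_div_sub _ k (tendsto_natCast_rpow_atTop hα))
      (fun α hα => ?_) fun α hα => ?_
    · simp only [rpow_pow_eq _ 4 1 (show (1 / 4 : ℝ) * (4 : ℕ) = (1 : ℕ) by norm_num), pow_one]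
      exact tendsto_mul_Kcurve_sub_KRay betaC_pos b k hα
    · have hs : Tendsto (fun n : ℕ => ((n : ℝ) ^ (1 / 4 * α)) ^ 2) atTop atTop :=
        (tendsto_pow_atTop two_ne_zero).comp (tendsto_natCast_rpow_atTop (by positivity))
      refine ((tendsto_mul_exp_betaRay_sub b hα).div_atTop hs).congr' ?_
      filter_upwards [hs.eventually_gt_atTop 0] with n hn
      have h4 : (n : ℝ) ^ α = ((n : ℝ) ^ (1 / 4 * α)) ^ 2 * ((n : ℝ) ^ (1 / 4 * α)) ^ 2 := by
        rw [← pow_add, rpow_pow_eq _ (2 + 2) 1 (by norm_num), pow_one]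
      rw [h4]
      field_simp
  · intro l l' hl
    have hlim := fun α (hα : 0 < α) => tendsto_mul_Kcurve_sub_KRight l l' hα
    refine exists_hypotheses_betaC (M := 4 * 1)
      (L := (iteratedDeriv 2 Kcurve betaC - l) * 1 ^ 2 / Nat.factorial 2)
      (by simp) (by norm_num) (by norm_num) (by norm_num)
      (Or.inr ⟨by norm_num, ?_⟩) (k := deriv Kcurve betaC * 1) (by simp)
      (fun α hα => tendsto_mul_sub_Kcurve betaC_pos le_rfl (tendsto_natCast_rpow_atTop hα)
        (hlim α hα)) (fun α hα => ?_) fun α hα => ?_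
    · have hβ := betaC_pos
      have h1 : iteratedDeriv 2 Kcurve betaC - l < 5 / (4 * betaC) := sub_lt_comm.mp hl
      rw [lt_div_iff₀ (by positivity)] at h1
      norm_num
      linarith
    · simp only [rpow_pow_eq _ 4 2 (show (1 / 2 : ℝ) * (4 : ℕ) = (2 : ℕ) by norm_num)]
      exact hlim α hα
    · simp only [rpow_pow_eq _ 2 1 (show (1 / 2 : ℝ) * (2 : ℕ) = (1 : ℕ) by norm_num), pow_one]
      exact tendsto_mul_exp_betaRay_sub 1 hα
  · intro l hl
    have hlim := fun α (hα : 0 < α) =>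
      tendsto_mul_Kcurve_sub_KTaylor betaC_pos (-1) l one_le_two hα
    simp only [← KLeft_eq] at hlim
    refine exists_hypotheses_betaC (M := 4 * -1)
      (L := (iteratedDeriv 2 Kcurve betaC - l) * (-1) ^ 2 / Nat.factorial 2)
      (by simp) (by norm_num) (by norm_num) (by norm_num)
      (Or.inl ⟨mul_neg_of_pos_of_neg betaC_pos ?_, by norm_num⟩)
      (k := deriv Kcurve betaC * -1) (by simp)
      (fun α hα => tendsto_mul_sub_Kcurve betaC_pos le_rfl (tendsto_natCast_rpow_atTop hα)
        (hlim α hα)) (fun α hα => ?_) fun α hα => ?_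
    · norm_num
      linarith
    · simp only [rpow_pow_eq _ 4 2 (show (1 / 2 : ℝ) * (4 : ℕ) = (2 : ℕ) by norm_num)]
      exact hlim α hα
    · simp only [rpow_pow_eq _ 2 1 (show (1 / 2 : ℝ) * (2 : ℕ) = (1 : ℕ) by norm_num), pow_one]
      exact tendsto_mul_exp_betaRay_sub (-1) hα
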